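/- Let $d\ge 1$, $s\ge 0$, $p,q\in[1,+\infty)$. Let $(V_j)_{j\in\mathbb Z}$ be an orthogonal multiresolution analysis of $L^2(\mathbb R^d)$ (complex-valued functions) with scaling function $\varphi$, and let $\psi^{(i)}$, $1\le i\le 2^d-1$, be an associated wavelet basis: the $\psi^{(i)}(\cdot-k)$, $k\in\mathbb Z^d$, belong to $V_1\ominus V_0$, and the functions $2^{dj/2}\psi^{(i)}(2^j\cdot-k)$ ($1\le i\le 2^d-1$, $j\in\mathbb Z$, $k\in\mathbb Z^d$) form an orthonormal basis of $L^2(\mathbb R^d)$. Assume that $\varphi$ and the $\psi^{(i)}$ are of class $C^{\lfloor s\rfloor+1}$ and that all their derivatives of order at most $\lfloor s\rfloor+1$ (including order $0$) are $O((1+\|x\|)^{-N})$ for every $N\ge 0$. For $f\in L^p(\mathbb R^d)$ set $C_k(f)=\int f(x)\overline{\varphi(x-k)}\,dx$, $c^{(i)}_{j,k}(f)=2^{dj}\int f(x)\overline{\psi^{(i)}(2^jx-k)}\,dx$ and, for $x\in\mathbb R^d$ and $j\ge 0$, $$P_jf(x)=\sum_{k\in\mathbb Z^d}C_k(f)\,\varphi(x-k)+\sum_{0\le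 l<j}\ \sum_{i=1}^{2^d-1}\ \sum_{k\in\mathbb Z^d}c^{(i)}_{l,k}(f)\,\psi^{(i)}(2^lx-k).$$ Let $X$ be one of the following spaces, with the topology of its norm. * The Besov space $B_p^{s,q}(\mathbb R^d)$: the functions $f\in L^p(\mathbb R^d)$ whose norm $\|(C_k(f))_k\|_{\ell^p}+\|(\varepsilon_j)_{j\ge 0}\|_{\ell^q}$ is finite, where $\varepsilon_j=2^{(s-d/p)j}\big(\sum_{i,k}|c^{(i)}_{j,k}(f)|^p\big)^{1/p}$. * The Sobolev space $W^{p,s}(\mathbb R^d)$, in either of its usual definitions for real $s$. (a) The functions $f\in L^p$ whose weak derivatives of order at most $m=\lfloor s\rfloor$ are in $L^p$ and, if $\sigma=s-m>0$, whose derivatives $g$ of order $m$ satisfy $\iint \frac{|g(x)-g(y)|^p}{|x-y|^{d+\sigma p}}\,dx\,dy<\infty$, with the usual norm. (b) The functions $f\in L^p$ with $(1-\Delta)^{s/2}f\in L^p$, with the usual norm. Then there is a residual subset $R$ of $X$ (indeed a dense $G_\delta$ set) such that, for every $f\in R$ and every $x\in\mathbb R^d$, $$\liminf_{j\to+\infty}\frac{\log^+|P_jf(x)|}{j\log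 2}=0 .$$ Consequently, suppose that $d-sp>0$ and, for $\beta>0$, put $E(\beta,f)=\{x\in\mathbb R^d:\ \lim_{j}\frac{\log|P_jf(x)|}{j\log 2}=\beta\}$. Then the set $S$ of all $f\in X$ such that $$\dim_{\mathcal H}E(\beta,f)=\dim_{\mathcal P}E(\beta,f)=d-sp-\beta p\quad\text{for all }\beta\in\left(0,\tfrac dp-s\right]$$ (where $\dim_{\mathcal H}$ and $\dim_{\mathcal P}$ denote the Hausdorff and packing dimensions) is meagre in $X$, and $S$ is not residual in $X$; in the case of the Besov space with $s=0$, the non-residuality is asserted whenever $X$ is a Baire space. -/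

import Mathlib

open MeasureTheory Filter Topology
open scoped ENNReal NNReal ComplexConjugate SchwartzMap LineDeriv

noncomputable section

/-- The space `ℝ^d`. -/
abbrev RSpace (d : ℕ) : Type := EuclideanSpace ℝ (Fin d)

/-- The point of `ℝ^d` with integer coordinates `k`. -/
def latticePoint {d : ℕ} (k : Fin d → ℤ) : RSpace d := WithLp.toLp 2 (fun i => (k i : ℝ))

/-! ### Multiresolution analyses and wavelets -/

/-- `V` is an orthogonal multiresolution analysis of `L²(ℝ^d)` with scaling function `φ`. -/
structure IsMRA {d : ℕ} (V : ℤ → Submodule ℂ (Lp ℂ 2 (volume : Measure (RSpace d))))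
    (φ : RSpace d → ℂ) : Prop where
  isClosed : ∀ j, IsClosed (V j : Set (Lp ℂ 2 (volume : Measure (RSpace d))))
  mono : ∀ j, V j ≤ V (j + 1)
  inter : ⨅ j, V j = ⊥
  dense : Dense (⋃ j, (V j : Set (Lp ℂ 2 (volume : Measure (RSpace d)))))
  dilation : ∀ (j : ℤ) (f g : Lp ℂ 2 (volume : Measure (RSpace d))),
    (g =ᵐ[volume] fun x => f ((2 : ℝ) • x)) → (f ∈ V j ↔ g ∈ V (j + 1))
  basis : ∃ e : (Fin d → ℤ) → Lp ℂ 2 (volume : Measure (RSpace d)),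
    (∀ k, e k =ᵐ[volume] fun x => φ (x - latticePoint k)) ∧
    Orthonormal ℂ e ∧ (Submodule.span ℂ (Set.range e)).topologicalClosure = V 0

/-- The functions `ψ i`, `1 ≤ i ≤ 2^d - 1`, form a wavelet basis associated with `V`: the functions
`2^{dj/2} ψ i (2^j x - k)` form an orthonormal basis of `L²(ℝ^d)`, and those of level `j = 0`
belong to the orthogonal complement of `V 0` in `V 1`. -/
def IsWaveletBasis {d : ℕ} (V : ℤ → Submodule ℂ (Lp ℂ 2 (volume : Measure (RSpace d))))
    (ψ : Fin (2 ^ d - 1) → RSpace d → ℂ) : Prop :=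
  ∃ e : Fin (2 ^ d - 1) × ℤ × (Fin d → ℤ) → Lp ℂ 2 (volume : Measure (RSpace d)),
    (∀ i j k, e (i, j, k) =ᵐ[volume] fun x =>
      (((2 : ℝ) ^ ((d : ℝ) * (j : ℝ) / 2) : ℝ) : ℂ) * ψ i ((2 : ℝ) ^ j • x - latticePoint k)) ∧
    Orthonormal ℂ e ∧ (Submodule.span ℂ (Set.range e)).topologicalClosure = ⊤ ∧
    ∀ i k, e (i, 0, k) ∈ V 1 ⊓ (V 0)ᗮ

/-- `g` is of class `C^r` and its derivatives up to order `r` (in particular `g` itself) have fast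
decay. -/
def HasFastDecay {d : ℕ} (r : ℕ) (g : RSpace d → ℂ) : Prop :=
  ContDiff ℝ r g ∧ ∀ m ≤ r, ∀ N : ℕ, ∃ C : ℝ, ∀ x, ‖iteratedFDeriv ℝ m g x‖ ≤ C / (1 + ‖x‖) ^ N

/-- A multiresolution analysis of `L²(ℝ^d)`, with its scaling function and an associated wavelet
basis, of regularity `r`. -/
structure WaveletSystem (d r : ℕ) where
  V : ℤ → Submodule ℂ (Lp ℂ 2 (volume : Measure (RSpace d)))
  φ : RSpace d → ℂ
  ψ : Fin (2 ^ d - 1) → RSpace d → ℂ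
  isMRA : IsMRA V φ
  isWaveletBasis : IsWaveletBasis V ψ
  decay_φ : HasFastDecay r φ
  decay_ψ : ∀ i, HasFastDecay r (ψ i)

namespace WaveletSystem

variable {d r : ℕ} (W : WaveletSystem d r)

/-- `C_k = ∫ conj(φ(x - k)) f(x) dx`. -/
def scalingCoeff (f : RSpace d → ℂ) (k : Fin d → ℤ) : ℂ :=
  ∫ x, conj (W.φ (x - latticePoint k)) * f x

/-- The dilated wavelet `ψ_{j,k}^{(i)}(x) = ψ^{(i)}(2^j x - k)`, `j ≥ 0`
(normalized in `L^∞`). -/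
def wavelet (j : ℕ) (i : Fin (2 ^ d - 1)) (k : Fin d → ℤ) (x : RSpace d) : ℂ :=
  W.ψ i ((2 : ℝ) ^ j • x - latticePoint k)

/-- `c_{j,k}^{(i)} = ∫ 2^{dj} conj(ψ_{j,k}^{(i)}(x)) f(x) dx`. -/
def waveletCoeff (f : RSpace d → ℂ) (j : ℕ) (i : Fin (2 ^ d - 1)) (k : Fin d → ℤ) : ℂ :=
  ∫ x, (2 : ℂ) ^ (d * j) * conj (W.wavelet j i k x) * f x

/-- The partial reconstruction `P_j f(x)`, `j ≥ 0`. For `f ∈ L^p` both series over `ℤ^d` converge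
absolutely at every point, by the fast decay of `φ` and of the wavelets. -/
def partialSum (f : RSpace d → ℂ) (j : ℕ) (x : RSpace d) : ℂ :=
  (∑' k : Fin d → ℤ, W.scalingCoeff f k * W.φ (x - latticePoint k)) +
    ∑ l ∈ Finset.range j, ∑ i : Fin (2 ^ d - 1), ∑' k : Fin d → ℤ,
      W.waveletCoeff f l i k * W.wavelet l i k x

/-- The divergence set `E(β, f) = {x : lim_j log |P_j f(x)| / (j log 2) = β}`, for `β > 0`. -/
def divergenceSet (β : ℝ) (f : RSpace d → ℂ) : Set (RSpace d) :=
  {x | Tendsto (fun j : ℕ => Real.log ‖W.partialSum f j x‖ / (j * Real.log 2)) atTop (𝓝 β)}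

end WaveletSystem

/-! ### Packing dimension -/

/-- The upper box dimension `limsup_{δ → 0} log N_δ(A) / log (1/δ)`, where `N_δ(A)` is the least
number of balls of radius `δ` covering `A`. -/
def upperBoxDim {X : Type*} [PseudoEMetricSpace X] (A : Set X) : ℝ≥0∞ :=
  limsup (fun δ : ℝ≥0 => (ENNReal.log (Metric.coveringNumber δ A : ℝ≥0∞)).toENNReal /
    ENNReal.ofReal (Real.log (δ : ℝ)⁻¹)) (𝓝[>] 0)

/-- The packing dimension: the infimum, over the countable covers of `A`, of the supremum of the
upper box dimensions of the pieces. -/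
def packingDim {X : Type*} [PseudoEMetricSpace X] (A : Set X) : ℝ≥0∞ :=
  ⨅ (B : ℕ → Set X) (_ : A ⊆ ⋃ n, B n), ⨆ n, upperBoxDim (B n)

/-- The property "for all `β ∈ (0, d/p - s]`, the Hausdorff and the packing dimension of `E(β, f)` are
both equal to `d - sp - βp`". -/
def WaveletSystem.IsStronglyMultifractal {d r : ℕ} (W : WaveletSystem d r) (s p : ℝ)
    (f : RSpace d → ℂ) : Prop :=
  ∀ β : ℝ, 0 < β → β ≤ d / p - s →
    dimH (W.divergenceSet β f) = ENNReal.ofReal (d - s * p - β * p) ∧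
    packingDim (W.divergenceSet β f) = ENNReal.ofReal (d - s * p - β * p)

/-! ### Function spaces given by an extended norm -/

/-- A subadditive even functional with values in `[0, ∞]`, vanishing at `0`. -/
structure ExtendedNorm (G : Type*) [AddCommGroup G] where
  toFun : G → ℝ≥0∞
  map_zero : toFun 0 = 0
  map_neg : ∀ f, toFun (-f) = toFun f
  map_add_le : ∀ f g, toFun (f + g) ≤ toFun f + toFun g

namespace ExtendedNorm

variable {G : Type*} [AddCommGroup G] (N : ExtendedNorm G)

/-- The elements with finite norm. -/
def finiteSubgroup : AddSubgroup G where
  carrier := {f | N.toFun f < ∞}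
  zero_mem' := by simp [N.map_zero]
  add_mem' := fun {f g} hf hg =>
    (N.map_add_le f g).trans_lt (ENNReal.add_lt_top.2 ⟨hf, hg⟩)
  neg_mem' := fun {f} hf => by simpa [N.map_neg] using hf

/-- The space of the elements with finite norm, with the topology of that norm. -/
def Space : Type _ := N.finiteSubgroup

instance : AddCommGroup N.Space := inferInstanceAs (AddCommGroup N.finiteSubgroup)

variable {N} in
/-- The underlying element. -/
def Space.val (f : N.Space) : G := Subtype.val f

instance : SeminormedAddCommGroup N.Space :=
  AddGroupSeminorm.toSeminormedAddCommGroup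
    { toFun := fun f => (N.toFun f.val).toReal
      map_zero' := by
        have h : (0 : N.Space).val = 0 := rfl
        simp [h, N.map_zero]
      add_le' := fun f g => by
        have h : (f + g).val = f.val + g.val := rfl
        have hf : N.toFun f.val < ∞ := f.2
        have hg : N.toFun g.val < ∞ := g.2
        rw [h, ← ENNReal.toReal_add hf.ne hg.ne]
        exact ENNReal.toReal_mono (ENNReal.add_lt_top.2 ⟨hf, hg⟩).ne (N.map_add_le _ _)
      neg' := fun f => by
        have h : (-f).val = -f.val := rfl
        rw [h, N.map_neg] }

end ExtendedNorm

/-! ### Besov spaces -/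

theorem HasFastDecay.integrable {d r : ℕ} {g : RSpace d → ℂ} (hg : HasFastDecay r g) :
    Integrable g := by
  obtain ⟨C, hC⟩ := hg.2 0 (Nat.zero_le r) (d + 1)
  have h1 : Integrable (fun x : RSpace d => C * (1 + ‖x‖) ^ (-((d : ℝ) + 1))) :=
    (integrable_one_add_norm (by simp)).const_mul C
  refine h1.mono' hg.1.continuous.aestronglyMeasurable (Eventually.of_forall fun x => ?_)
  have h2 := hC x
  rw [norm_iteratedFDeriv_zero] at h2
  rw [Real.rpow_neg (by positivity), ← div_eq_mul_inv]
  have h3 : (1 + ‖x‖) ^ ((d : ℝ) + 1) = (1 + ‖x‖) ^ (d + 1) := by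
    rw [← Real.rpow_natCast]; push_cast; rfl
  rwa [h3]

theorem integrable_conj_mul_of_bounded {d : ℕ} {p : ℝ≥0∞} [hp : Fact (1 ≤ p)]
    {g : RSpace d → ℂ} (hc : Continuous g) (hi : Integrable g) {B : ℝ} (hB : ∀ x, ‖g x‖ ≤ B)
    (f : Lp ℂ p (volume : Measure (RSpace d))) :
    Integrable (fun x => conj (g x) * f x) := by
  have hq : ENNReal.HolderConjugate p (1 - p⁻¹)⁻¹ :=
    ENNReal.HolderConjugate.inv_one_sub_inv' hp.out
  have hq' := hq.symm
  have h1 : 1 ≤ (1 - p⁻¹)⁻¹ := by simp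
  generalize (1 - p⁻¹)⁻¹ = q at hq hq' h1
  have hm : MemLp g q (volume : Measure (RSpace d)) := by
    rcases eq_or_ne q ∞ with rfl | hqt
    · exact memLp_top_of_bound hc.aestronglyMeasurable B (Eventually.of_forall hB)
    have hq1 : 1 ≤ q.toReal := by
      rw [← ENNReal.toReal_one]
      exact ENNReal.toReal_mono hqt h1
    rw [← integrable_norm_rpow_iff hc.aestronglyMeasurable (by positivity) hqt]
    refine (hi.norm.const_mul (B ^ (q.toReal - 1))).mono' ?_ (Eventually.of_forall fun x => ?_)
    · exact (hc.norm.rpow_const fun x => Or.inr (by positivity)).aestronglyMeasurable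
    · rw [Real.norm_of_nonneg (by positivity)]
      rcases eq_or_lt_of_le (norm_nonneg (g x)) with h0 | h0
      · rw [← h0, Real.zero_rpow (by positivity)]; simp
      · calc ‖g x‖ ^ q.toReal = ‖g x‖ ^ (q.toReal - 1) * ‖g x‖ := by
              rw [← Real.rpow_add_one h0.ne']; simp
          _ ≤ B ^ (q.toReal - 1) * ‖g x‖ := by
              have h2 : 0 ≤ q.toReal - 1 := by linarith
              gcongr
              exact hB x
  have hm' : MemLp (fun x => conj (g x)) q (volume : Measure (RSpace d)) := hm.star
  exact hm'.integrable_mul (Lp.memLp f)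

theorem HasFastDecay.bounded {d r : ℕ} {g : RSpace d → ℂ} (hg : HasFastDecay r g) :
    ∃ B : ℝ, ∀ x, ‖g x‖ ≤ B := by
  obtain ⟨C, hC⟩ := hg.2 0 (Nat.zero_le r) 0
  exact ⟨C, fun x => by simpa using hC x⟩

theorem eLpNorm_count_add_le {α ε : Type*} [MeasurableSpace α] [MeasurableSingletonClass α]
    [Countable α] [TopologicalSpace ε] [ESeminormedAddMonoid ε]
    {p : ℝ≥0∞} (hp : 1 ≤ p) (u v : α → ε) :
    eLpNorm (u + v) p Measure.count ≤ eLpNorm u p Measure.count + eLpNorm v p Measure.count :=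
  eLpNorm_add_le StronglyMeasurable.of_discrete.aestronglyMeasurable
    StronglyMeasurable.of_discrete.aestronglyMeasurable hp

namespace WaveletSystem

variable {d r : ℕ} (W : WaveletSystem d r)

/-- The Besov norm: the `ℓ^p` norm of `(C_k)` plus the `ℓ^q` norm of `(ε_j)_{j ≥ 0}`, where
`ε_j = 2^{(s - d/p) j} (∑_{i,k} |c_{j,k}^{(i)}|^p)^{1/p}`. -/
def besovENorm (s : ℝ) (p q : ℝ≥0∞) (f : RSpace d → ℂ) : ℝ≥0∞ :=
  eLpNorm (W.scalingCoeff f) p Measure.count +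
    eLpNorm (fun j : ℕ => ENNReal.ofReal (2 ^ ((s - d / p.toReal) * j)) *
      eLpNorm (fun a : Fin (2 ^ d - 1) × (Fin d → ℤ) => W.waveletCoeff f j a.1 a.2) p
        Measure.count) q Measure.count

variable {W} in
theorem scalingCoeff_congr {f g : RSpace d → ℂ} (h : f =ᵐ[volume] g) :
    W.scalingCoeff f = W.scalingCoeff g := by
  funext k
  exact integral_congr_ae (h.mono fun x hx => by simp [hx])

variable {W} in
theorem waveletCoeff_congr {f g : RSpace d → ℂ} (h : f =ᵐ[volume] g) :
    W.waveletCoeff f = W.waveletCoeff g := by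
  funext j i k
  exact integral_congr_ae (h.mono fun x hx => by simp [hx])

theorem scalingCoeff_neg (f : RSpace d → ℂ) : W.scalingCoeff (-f) = -W.scalingCoeff f := by
  funext k
  simp [scalingCoeff, integral_neg]

theorem waveletCoeff_neg (f : RSpace d → ℂ) : W.waveletCoeff (-f) = -W.waveletCoeff f := by
  funext j i k
  simp [waveletCoeff, integral_neg]

theorem scalingCoeff_zero : W.scalingCoeff 0 = 0 := by
  funext k
  simp [scalingCoeff]

theorem waveletCoeff_zero : W.waveletCoeff 0 = 0 := by
  funext j i k
  simp [waveletCoeff]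

theorem scalingCoeff_add {p : ℝ≥0∞} [Fact (1 ≤ p)]
    (f g : Lp ℂ p (volume : Measure (RSpace d))) :
    W.scalingCoeff (⇑f + ⇑g) = W.scalingCoeff f + W.scalingCoeff g := by
  funext k
  obtain ⟨B, hB⟩ := W.decay_φ.bounded
  have h := integrable_conj_mul_of_bounded (p := p)
    (g := fun x => W.φ (x - latticePoint k))
    (W.decay_φ.1.continuous.comp (continuous_id.sub continuous_const))
    (W.decay_φ.integrable.comp_sub_right _) (fun x => hB _)
  simp only [scalingCoeff, Pi.add_apply, mul_add]
  exact integral_add (h f) (h g)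

theorem waveletCoeff_add {p : ℝ≥0∞} [Fact (1 ≤ p)]
    (f g : Lp ℂ p (volume : Measure (RSpace d))) :
    W.waveletCoeff (⇑f + ⇑g) = W.waveletCoeff f + W.waveletCoeff g := by
  funext j i k
  obtain ⟨B, hB⟩ := (W.decay_ψ i).bounded
  have h := integrable_conj_mul_of_bounded (p := p) (g := W.wavelet j i k)
    ((W.decay_ψ i).1.continuous.comp ((continuous_const_smul _).sub continuous_const))
    (((W.decay_ψ i).integrable.comp_sub_right _).comp_smul (by positivity)) (fun x => hB _)
  simp only [waveletCoeff, Pi.add_apply, mul_add, mul_assoc]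
  exact integral_add ((h f).const_mul _) ((h g).const_mul _)

/-- The Besov space `B_p^{s,q}(ℝ^d)`, as the functions of `L^p` with finite Besov norm. -/
def besov (s : ℝ) (p q : ℝ≥0∞) [Fact (1 ≤ p)] [Fact (1 ≤ q)] :
    ExtendedNorm (Lp ℂ p (volume : Measure (RSpace d))) where
  toFun f := W.besovENorm s p q f
  map_zero := by
    have h := Lp.coeFn_zero ℂ p (volume : Measure (RSpace d))
    have h0 : (fun _ : ℕ => (0 : ℝ≥0∞)) = 0 := rfl
    rw [besovENorm, scalingCoeff_congr h, waveletCoeff_congr h, scalingCoeff_zero,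
      waveletCoeff_zero]
    simp [h0]
  map_neg f := by
    have h := Lp.coeFn_neg f
    have h1 : ∀ j : ℕ, (fun a : Fin (2 ^ d - 1) × (Fin d → ℤ) => -W.waveletCoeff f j a.1 a.2) =
      -(fun a : Fin (2 ^ d - 1) × (Fin d → ℤ) => W.waveletCoeff f j a.1 a.2) := fun j => rfl
    rw [besovENorm, besovENorm, scalingCoeff_congr h, waveletCoeff_congr h, scalingCoeff_neg,
      waveletCoeff_neg]
    simp [h1, eLpNorm_neg]
  map_add_le f g := by
    have hp : 1 ≤ p := Fact.out
    have hq : 1 ≤ q := Fact.out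
    have h := Lp.coeFn_add f g
    simp only [besovENorm, scalingCoeff_congr h, waveletCoeff_congr h, scalingCoeff_add,
      waveletCoeff_add]
    refine (add_le_add (eLpNorm_count_add_le hp _ _) ((eLpNorm_mono_enorm fun j => ?_).trans
      (eLpNorm_count_add_le hq _ _))).trans (add_add_add_comm _ _ _ _).le
    simp only [enorm_eq_self, Pi.add_apply, ← mul_add]
    gcongr
    exact eLpNorm_count_add_le hp _ _

end WaveletSystem

/-! ### Sobolev spaces -/

section Sobolev

set_option linter.unusedSectionVars false

variable {d : ℕ} {p : ℝ≥0∞} [Fact (1 ≤ p)]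

/-- The `L^p` norm. -/
def lpENorm (g : Lp ℂ p (volume : Measure (RSpace d))) : ℝ≥0∞ := eLpNorm g p volume

theorem lpENorm_zero : lpENorm (0 : Lp ℂ p (volume : Measure (RSpace d))) = 0 := by
  rw [lpENorm, eLpNorm_congr_ae (Lp.coeFn_zero ℂ p (volume : Measure (RSpace d))), eLpNorm_zero]

theorem lpENorm_neg (f : Lp ℂ p (volume : Measure (RSpace d))) : lpENorm (-f) = lpENorm f := by
  rw [lpENorm, eLpNorm_congr_ae (Lp.coeFn_neg f), eLpNorm_neg, lpENorm]

theorem lpENorm_add_le (f g : Lp ℂ p (volume : Measure (RSpace d))) :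
    lpENorm (f + g) ≤ lpENorm f + lpENorm g := by
  rw [lpENorm, eLpNorm_congr_ae (Lp.coeFn_add f g)]
  exact eLpNorm_add_le (Lp.aestronglyMeasurable f) (Lp.aestronglyMeasurable g) Fact.out

/-- `Φ g` if the tempered distribution `u` is given by a function `g` of `L^p` (which is then
unique), and `∞` otherwise. -/
def extendENorm (Φ : Lp ℂ p (volume : Measure (RSpace d)) → ℝ≥0∞) (u : 𝓢'(RSpace d, ℂ)) : ℝ≥0∞ :=
  ⨅ (g : Lp ℂ p (volume : Measure (RSpace d))) (_ : (g : 𝓢'(RSpace d, ℂ)) = u), Φ g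

theorem extendENorm_zero {Φ : Lp ℂ p (volume : Measure (RSpace d)) → ℝ≥0∞} (h : Φ 0 = 0) :
    extendENorm Φ 0 = 0 := by
  refine le_antisymm ?_ zero_le
  refine (iInf₂_le 0 ?_).trans h.le
  rw [← Lp.toTemperedDistributionCLM_apply, map_zero]

theorem extendENorm_add_le {Φ : Lp ℂ p (volume : Measure (RSpace d)) → ℝ≥0∞}
    (h : ∀ f g, Φ (f + g) ≤ Φ f + Φ g) (u v : 𝓢'(RSpace d, ℂ)) :
    extendENorm Φ (u + v) ≤ extendENorm Φ u + extendENorm Φ v := by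
  simp only [extendENorm, ENNReal.iInf_add, ENNReal.add_iInf]
  refine le_iInf fun g => le_iInf fun hg => le_iInf fun f => le_iInf fun hf => ?_
  refine (iInf₂_le (f + g) ?_).trans (h f g)
  rw [← hf, ← hg]
  simp only [← Lp.toTemperedDistributionCLM_apply, map_add]

theorem extendENorm_neg {Φ : Lp ℂ p (volume : Measure (RSpace d)) → ℝ≥0∞}
    (h : ∀ f, Φ (-f) = Φ f) (u : 𝓢'(RSpace d, ℂ)) : extendENorm Φ (-u) = extendENorm Φ u := by
  have key : ∀ w : 𝓢'(RSpace d, ℂ), extendENorm Φ (-w) ≤ extendENorm Φ w := fun w => by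
    refine le_iInf fun f => le_iInf fun hf => (iInf₂_le (-f) ?_).trans (h f).le
    rw [← hf]
    simp only [← Lp.toTemperedDistributionCLM_apply, map_neg]
  exact le_antisymm (key u) (by simpa using key (-u))

theorem toTemperedDistribution_zero :
    ((0 : Lp ℂ p (volume : Measure (RSpace d))) : 𝓢'(RSpace d, ℂ)) = 0 := by
  rw [← Lp.toTemperedDistributionCLM_apply, map_zero]

theorem toTemperedDistribution_add (f g : Lp ℂ p (volume : Measure (RSpace d))) :
    ((f + g : Lp ℂ p (volume : Measure (RSpace d))) : 𝓢'(RSpace d, ℂ)) =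
      (f : 𝓢'(RSpace d, ℂ)) + (g : 𝓢'(RSpace d, ℂ)) := by
  simp only [← Lp.toTemperedDistributionCLM_apply, map_add]

theorem toTemperedDistribution_neg (f : Lp ℂ p (volume : Measure (RSpace d))) :
    ((-f : Lp ℂ p (volume : Measure (RSpace d))) : 𝓢'(RSpace d, ℂ)) =
      -(f : 𝓢'(RSpace d, ℂ)) := by
  simp only [← Lp.toTemperedDistributionCLM_apply, map_neg]

/-- The seminorm `(∬ |g x - g y|^p / |x - y|^{d + σp} dx dy)^{1/p}`. -/
def gagliardoENorm (σ : ℝ) (g : Lp ℂ p (volume : Measure (RSpace d))) : ℝ≥0∞ :=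
  eLpNorm (fun z : RSpace d × RSpace d =>
    (g z.1 - g z.2) / ((‖z.1 - z.2‖ ^ (d / p.toReal + σ) : ℝ) : ℂ)) p (volume.prod volume)

theorem gagliardoENorm_congr (p : ℝ≥0∞) (σ : ℝ) (u v : RSpace d → ℂ) (h : u =ᵐ[volume] v) :
    (fun z : RSpace d × RSpace d =>
      (u z.1 - u z.2) / ((‖z.1 - z.2‖ ^ (d / p.toReal + σ) : ℝ) : ℂ)) =ᵐ[volume.prod volume]
    (fun z : RSpace d × RSpace d =>
      (v z.1 - v z.2) / ((‖z.1 - z.2‖ ^ (d / p.toReal + σ) : ℝ) : ℂ)) := by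
  filter_upwards [Measure.quasiMeasurePreserving_fst.ae_eq_comp h,
    Measure.quasiMeasurePreserving_snd.ae_eq_comp h] with z h1 h2
  simp only [Function.comp_apply] at h1 h2
  rw [h1, h2]

theorem gagliardoENorm_zero (σ : ℝ) :
    gagliardoENorm σ (0 : Lp ℂ p (volume : Measure (RSpace d))) = 0 := by
  rw [gagliardoENorm, eLpNorm_congr_ae
    (gagliardoENorm_congr p σ _ _ (Lp.coeFn_zero ℂ p (volume : Measure (RSpace d))))]
  simp

theorem gagliardoENorm_neg (σ : ℝ) (f : Lp ℂ p (volume : Measure (RSpace d))) :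
    gagliardoENorm σ (-f) = gagliardoENorm σ f := by
  rw [gagliardoENorm, gagliardoENorm, eLpNorm_congr_ae
    (gagliardoENorm_congr p σ _ _ (Lp.coeFn_neg f)), ← eLpNorm_neg]
  congr 1
  funext z
  simp only [Pi.neg_apply]
  ring

theorem gagliardoENorm_add_le (σ : ℝ) (f g : Lp ℂ p (volume : Measure (RSpace d))) :
    gagliardoENorm σ (f + g) ≤ gagliardoENorm σ f + gagliardoENorm σ g := by
  have hm : ∀ f : Lp ℂ p (volume : Measure (RSpace d)),
      AEStronglyMeasurable (fun z : RSpace d × RSpace d =>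
        (f z.1 - f z.2) / ((‖z.1 - z.2‖ ^ (d / p.toReal + σ) : ℝ) : ℂ))
        (volume.prod volume) := fun f => by
    have hf := (Lp.stronglyMeasurable f).measurable
    refine Measurable.aestronglyMeasurable ?_
    fun_prop
  rw [gagliardoENorm, eLpNorm_congr_ae
    (gagliardoENorm_congr p σ _ _ (Lp.coeFn_add f g))]
  refine le_trans (le_of_eq ?_) (eLpNorm_add_le (hm f) (hm g) Fact.out)
  congr 1
  funext z
  simp only [Pi.add_apply]
  ring

/-- The distributional partial derivative `∂_{a_1} ⋯ ∂_{a_n} u`. -/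
def partialDeriv {n : ℕ} (a : Fin n → Fin d) (u : 𝓢'(RSpace d, ℂ)) : 𝓢'(RSpace d, ℂ) :=
  ∂^{fun i => (EuclideanSpace.single (a i) (1 : ℝ) : RSpace d)} u

/-- The Sobolev norm of order `s = m + σ`, `m = ⌊s⌋`: the sum of the `L^p` norms of the derivatives
of order at most `m` and, when `σ > 0`, of the Gagliardo seminorms of order `σ` of the derivatives
of order `m`. -/
def sobolevENorm (s : ℝ) (u : 𝓢'(RSpace d, ℂ)) (p : ℝ≥0∞) [Fact (1 ≤ p)] : ℝ≥0∞ :=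
  (∑ n ∈ Finset.range (⌊s⌋₊ + 1), ∑ a : Fin n → Fin d,
    extendENorm (p := p) lpENorm (partialDeriv a u)) +
  (if s = ⌊s⌋₊ then 0 else ∑ a : Fin ⌊s⌋₊ → Fin d,
    extendENorm (p := p) (gagliardoENorm (s - ⌊s⌋₊)) (partialDeriv a u))

/-- The Sobolev space `W^{p,s}(ℝ^d)`, `s ≥ 0` (the Sobolev–Slobodeckij space when `s` is not an
integer). -/
def sobolev (d : ℕ) (s : ℝ) (p : ℝ≥0∞) [Fact (1 ≤ p)] :
    ExtendedNorm (Lp ℂ p (volume : Measure (RSpace d))) where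
  toFun f := sobolevENorm s (f : 𝓢'(RSpace d, ℂ)) p
  map_zero := by
    simp [sobolevENorm, partialDeriv, toTemperedDistribution_zero, extendENorm_zero, lpENorm_zero,
      gagliardoENorm_zero]
  map_neg f := by
    simp [sobolevENorm, partialDeriv, toTemperedDistribution_neg, extendENorm_neg, lpENorm_neg,
      gagliardoENorm_neg]
  map_add_le f g := by
    simp only [sobolevENorm, partialDeriv, toTemperedDistribution_add,
      LineDeriv.iteratedLineDerivOp_add]
    refine le_trans (add_le_add (b := _ + _) (d := _ + _) ?_ ?_)
      (add_add_add_comm _ _ _ _).le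
    · simp only [← Finset.sum_add_distrib]
      exact Finset.sum_le_sum fun n _ => Finset.sum_le_sum fun a _ =>
        extendENorm_add_le lpENorm_add_le _ _
    · split_ifs
      · simp
      · simp only [← Finset.sum_add_distrib]
        exact Finset.sum_le_sum fun a _ => extendENorm_add_le (gagliardoENorm_add_le _) _ _

/-- The Sobolev space of Bessel potentials `H^{s,p}(ℝ^d)`, `s ≥ 0`: the functions `f` of `L^p` such
that `(1 - Δ)^{s/2} f` belongs to `L^p`. The norm is `‖f‖_p + ‖(1 - Δ)^{s/2} f‖_p`, which is
equivalent to `‖(1 - Δ)^{s/2} f‖_p` since `s ≥ 0`. -/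
def besselSobolev (d : ℕ) (s : ℝ) (p : ℝ≥0∞) [Fact (1 ≤ p)] :
    ExtendedNorm (Lp ℂ p (volume : Measure (RSpace d))) where
  toFun f := lpENorm f + extendENorm (p := p) lpENorm
    (TemperedDistribution.besselPotential (RSpace d) ℂ s (f : 𝓢'(RSpace d, ℂ)))
  map_zero := by
    simp [toTemperedDistribution_zero, extendENorm_zero, lpENorm_zero]
  map_neg f := by
    simp [toTemperedDistribution_neg, extendENorm_neg, lpENorm_neg]
  map_add_le f g := by
    rw [toTemperedDistribution_add, map_add]
    exact (add_le_add (lpENorm_add_le f g)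
      (extendENorm_add_le lpENorm_add_le _ _)).trans
      (add_add_add_comm _ _ _ _).le

end Sobolev

end

/-!
The reason for the result is that the functions with bounded coefficients are dense. Write "atom"
for each of the functions `φ(x - k)` and `ψ i (2^l x - k)`. If all the coefficients of `f` are
bounded by one constant, as is the case when `f` is a bounded function, then, since the sums over
`k` of the absolute values of the atoms of one generator are bounded, `|P_j f| ≤ C (1 + j)`. Such an
`f` has, for every `n`, a neighbourhood of functions `g` with `|P_j g| ≤ (1 + j)^2` everywhere for
some `j ≥ n`, because the coefficients of finitely many scales depend continuously on `g`. The
functions having this property for all `n`, in the sense of interiors, form a `G_δ` set which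
contains the functions with bounded coefficients, and for these functions the lower limit is `0` at
every point. So the sets `E(β, f)` are empty for generic `f`, which makes the strongly multifractal
functions a meagre set, and a meagre set is not residual in a Baire space
(`WaveletSystem.generic_of_dense_tameSet`).

It remains to prove, for each of the spaces, that the functions with bounded coefficients are dense
and, for the last assertion, that the space is complete.

* Besov spaces. The finite combinations of atoms are dense, by dominated convergence for the
  coefficients and the biorthogonality relations (`WaveletSystem.coeff_atom`). If `s > 0`, the
  synthesis inequality `WaveletSystem.eLpNorm_sum_atom_le` shows that on these combinations the
  Besov norm dominates the `L^p` norm; as it is moreover lower semicontinuous on `L^p`, the space is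
  complete (`WaveletSystem.completeSpace_besov`). In this way the convergence of wavelet expansions
  in `L^p` is not needed.
* Sobolev spaces, in both definitions. The averages of the translates `f(· + t)` over small balls
  have bounded coefficients and converge to `f`
  (`IsTranslationContinuous.tendsto_localAverage`). This uses only that averages stay in closed
  convex sets: the graphs of the operators which define the norm
  (`CommutesWithTranslations.localAverage`) and the sublevel sets of the `L^p` norm and of the
  Gagliardo seminorm. Completeness holds because these operators are closed.
-/

noncomputable section

/-! ### Lattice sums of functions with fast decay -/

theorem one_le_norm_latticePoint_sub {d : ℕ} {k l : Fin d → ℤ} (h : k ≠ l) :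
    1 ≤ ‖latticePoint k - latticePoint l‖ := by
  obtain ⟨i, hi⟩ := Function.ne_iff.1 h
  have h1 : ‖(latticePoint k - latticePoint l) i‖ ≤ ‖latticePoint k - latticePoint l‖ :=
    PiLp.norm_apply_le _ i
  refine le_trans ?_ h1
  have h2 : (latticePoint k - latticePoint l) i = ((k i - l i : ℤ) : ℝ) := by
    simp [latticePoint]
  rw [h2, Real.norm_eq_abs, ← Int.cast_abs]
  exact_mod_cast Int.one_le_abs (sub_ne_zero.2 hi)

theorem lintegral_one_add_norm_pow_lt_top (d : ℕ) :
    ∫⁻ y : RSpace d, ENNReal.ofReal (((1 + ‖y‖) ^ (d + 1))⁻¹) < ∞ := by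
  have h1 : Integrable (fun x : RSpace d => (1 + ‖x‖) ^ (-((d : ℝ) + 1))) :=
    integrable_one_add_norm (by simp)
  have h2 := h1.lintegral_lt_top
  refine lt_of_eq_of_lt (lintegral_congr fun y => ?_) h2
  rw [Real.rpow_neg (by positivity)]
  congr 2
  rw [← Real.rpow_natCast]; push_cast; rfl

/-- The lattice sums of `(1 + ‖·‖)^{-(d+1)}` are bounded independently of the base point: each term
is comparable with the integral over the ball of radius `1/2` about the lattice point, and these
balls are disjoint. -/
theorem exists_tsum_one_add_norm_pow_le (d : ℕ) : ∃ A : ℝ≥0, ∀ x : RSpace d,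
    ∑' k : Fin d → ℤ, ENNReal.ofReal (((1 + ‖x - latticePoint k‖) ^ (d + 1))⁻¹) ≤ A := by
  set I := ∫⁻ y : RSpace d, ENNReal.ofReal (((1 + ‖y‖) ^ (d + 1))⁻¹) with hI
  have hIt : I < ∞ := lintegral_one_add_norm_pow_lt_top d
  set v := volume (Metric.ball (0 : RSpace d) (1 / 2)) with hv
  have hv0 : v ≠ 0 := (Metric.measure_ball_pos _ _ (by norm_num)).ne'
  have hvt : v ≠ ∞ := measure_ball_lt_top.ne
  have hfin : ENNReal.ofReal (2 ^ (d + 1)) * I / v ≠ ∞ :=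
    ENNReal.div_ne_top (ENNReal.mul_ne_top ENNReal.ofReal_ne_top hIt.ne) hv0
  refine ⟨(ENNReal.ofReal (2 ^ (d + 1)) * I / v).toNNReal, fun x => ?_⟩
  rw [ENNReal.coe_toNNReal hfin, ENNReal.le_div_iff_mul_le (Or.inl hv0) (Or.inl hvt),
    ← ENNReal.tsum_mul_right]
  set F : RSpace d → ℝ≥0∞ := fun y => ENNReal.ofReal (((1 + ‖x - y‖) ^ (d + 1))⁻¹) with hF
  have h1 : ∀ k : Fin d → ℤ, F (latticePoint k) * v ≤
      ENNReal.ofReal (2 ^ (d + 1)) * ∫⁻ y in Metric.ball (latticePoint k) (1 / 2), F y := by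
    intro k
    have h2 : v = volume (Metric.ball (latticePoint k : RSpace d) (1 / 2)) := by
      rw [hv, Measure.addHaar_ball_center volume (latticePoint k)]
    rw [h2, ← setLIntegral_const, ← lintegral_const_mul' _ _ ENNReal.ofReal_ne_top]
    refine setLIntegral_mono' measurableSet_ball fun y hy => ?_
    rw [hF, ← ENNReal.ofReal_mul (by positivity)]
    refine ENNReal.ofReal_le_ofReal ?_
    have h3 : 1 + ‖x - y‖ ≤ 2 * (1 + ‖x - latticePoint k‖) := by
      have h4 : ‖x - y‖ ≤ ‖x - latticePoint k‖ + ‖y - latticePoint k‖ := by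
        rw [← norm_sub_rev (latticePoint k) y]
        simpa using norm_add_le (x - latticePoint k) (latticePoint k - y)
      have h5 : ‖y - latticePoint k‖ < 1 / 2 := by simpa [dist_eq_norm] using hy
      have := norm_nonneg (x - latticePoint k)
      linarith
    rw [← div_eq_mul_inv, inv_eq_one_div, div_le_div_iff₀ (by positivity) (by positivity), one_mul,
      ← mul_pow]
    gcongr
  have hdisj : Pairwise (Function.onFun Disjoint
      fun k : Fin d → ℤ => Metric.ball (latticePoint k) (1 / 2 : ℝ)) := fun k l hkl => by
    refine Metric.ball_disjoint_ball ?_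
    rw [dist_eq_norm]
    have := one_le_norm_latticePoint_sub hkl
    linarith
  calc ∑' k : Fin d → ℤ, F (latticePoint k) * v
      ≤ ∑' k : Fin d → ℤ, ENNReal.ofReal (2 ^ (d + 1)) *
          ∫⁻ y in Metric.ball (latticePoint k) (1 / 2), F y := ENNReal.tsum_le_tsum h1
    _ = ENNReal.ofReal (2 ^ (d + 1)) *
          ∫⁻ y in ⋃ k : Fin d → ℤ, Metric.ball (latticePoint k) (1 / 2), F y := by
        rw [ENNReal.tsum_mul_left, lintegral_iUnion (fun _ => measurableSet_ball) hdisj]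
    _ ≤ ENNReal.ofReal (2 ^ (d + 1)) * I := by
        gcongr
        refine (setLIntegral_le_lintegral _ _).trans (le_of_eq ?_)
        exact lintegral_sub_left_eq_self (fun y => ENNReal.ofReal (((1 + ‖y‖) ^ (d + 1))⁻¹)) x

theorem HasFastDecay.exists_tsum_le {d r : ℕ} {g : RSpace d → ℂ} (hg : HasFastDecay r g) :
    ∃ A : ℝ≥0, ∀ x, ∑' k : Fin d → ℤ, ‖g (x - latticePoint k)‖ₑ ≤ A := by
  obtain ⟨C, hC⟩ := hg.2 0 (Nat.zero_le r) (d + 1)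
  obtain ⟨A, hA⟩ := exists_tsum_one_add_norm_pow_le d
  refine ⟨C.toNNReal * A, fun x => ?_⟩
  have h1 : ∀ y, ‖g y‖ₑ ≤ C.toNNReal * ENNReal.ofReal (((1 + ‖y‖) ^ (d + 1))⁻¹) := fun y => by
    have h2 := hC y
    rw [norm_iteratedFDeriv_zero, div_eq_mul_inv] at h2
    rw [← ofReal_norm]
    refine (ENNReal.ofReal_le_ofReal h2).trans ?_
    rw [ENNReal.ofReal_mul' (by positivity)]
    rfl
  calc ∑' k : Fin d → ℤ, ‖g (x - latticePoint k)‖ₑ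
      ≤ ∑' k : Fin d → ℤ, C.toNNReal *
          ENNReal.ofReal (((1 + ‖x - latticePoint k‖) ^ (d + 1))⁻¹) :=
        ENNReal.tsum_le_tsum fun k => h1 _
    _ ≤ _ := by
        rw [ENNReal.tsum_mul_left, ENNReal.coe_mul]
        gcongr
        exact hA x

theorem MeasureTheory.Integrable.memLp_of_bounded_of_one_le {α : Type*} [MeasurableSpace α]
    {μ : Measure α} {g : α → ℂ} (hi : Integrable g μ) {B : ℝ} (hB : ∀ x, ‖g x‖ ≤ B) {q : ℝ≥0∞}
    (h1 : 1 ≤ q) : MemLp g q μ := by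
  rcases eq_or_ne q ∞ with rfl | hqt
  · exact memLp_top_of_bound hi.1 B (Eventually.of_forall hB)
  have hq1 : 1 ≤ q.toReal := by
    rw [← ENNReal.toReal_one]
    exact ENNReal.toReal_mono hqt h1
  rw [← integrable_norm_rpow_iff hi.1 (by positivity) hqt]
  refine (hi.norm.const_mul (B ^ (q.toReal - 1))).mono' ?_ (Eventually.of_forall fun x => ?_)
  · exact (hi.1.norm.aemeasurable.pow_const _).aestronglyMeasurable
  · rw [Real.norm_of_nonneg (by positivity)]
    rcases eq_or_lt_of_le (norm_nonneg (g x)) with h0 | h0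
    · rw [← h0, Real.zero_rpow (by positivity)]; simp
    · calc ‖g x‖ ^ q.toReal = ‖g x‖ ^ (q.toReal - 1) * ‖g x‖ := by
            rw [← Real.rpow_add_one h0.ne']; simp
        _ ≤ B ^ (q.toReal - 1) * ‖g x‖ := by
            have h2 : 0 ≤ q.toReal - 1 := by linarith
            gcongr
            exact hB x

/-! ### The atoms of a wavelet system and their coefficients -/

/-- The generators of the expansion: `none` stands for the translates of `φ`, and `some (l, i)` for
the translates of `ψ i (2^l ·)`. -/
abbrev Gen (d : ℕ) : Type := Option (ℕ × Fin (2 ^ d - 1))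

/-- The dyadic scale of a generator. -/
def Gen.scale {d : ℕ} : Gen d → ℕ
  | none => 0
  | some a => a.1

/-- The generators which occur in the partial reconstruction `P_j f`. -/
def Gen.below (d j : ℕ) : Finset (Gen d) :=
  Finset.insertNone (Finset.range j ×ˢ Finset.univ)

namespace WaveletSystem

variable {d r : ℕ} (W : WaveletSystem d r)

/-- The function, among `φ` and the `ψ i`, from which the atoms of a generator are obtained. -/
def gen : Gen d → RSpace d → ℂ
  | none => W.φ
  | some a => W.ψ a.2

/-- The atoms `φ(x - k)` and `ψ i (2^l x - k)`, indexed by their generator and by `k`. -/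
def atom (b : Gen d) (k : Fin d → ℤ) (x : RSpace d) : ℂ :=
  W.gen b ((2 : ℝ) ^ b.scale • x - latticePoint k)

/-- The function against which `f` is integrated to obtain the coefficient of an atom. -/
def dualAtom (b : Gen d) (k : Fin d → ℤ) (x : RSpace d) : ℂ :=
  (2 : ℂ) ^ (d * b.scale) * conj (W.atom b k x)

/-- The coefficients `C_k` and `c_{l,k}^{(i)}`, with the index set of the atoms. -/
def coeff (f : RSpace d → ℂ) (b : Gen d) (k : Fin d → ℤ) : ℂ :=
  ∫ x, W.dualAtom b k x * f x

theorem atom_none (k : Fin d → ℤ) (x : RSpace d) :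
    W.atom none k x = W.φ (x - latticePoint k) := by
  simp [atom, Gen.scale, gen]

theorem coeff_none (f : RSpace d → ℂ) (k : Fin d → ℤ) :
    W.coeff f none k = W.scalingCoeff f k := by
  simp [coeff, scalingCoeff, dualAtom, atom_none, Gen.scale]

theorem coeff_some (f : RSpace d → ℂ) (l : ℕ) (i : Fin (2 ^ d - 1)) (k : Fin d → ℤ) :
    W.coeff f (some (l, i)) k = W.waveletCoeff f l i k := rfl

theorem partialSum_eq (f : RSpace d → ℂ) (j : ℕ) (x : RSpace d) :
    W.partialSum f j x = ∑ b ∈ Gen.below d j, ∑' k, W.coeff f b k * W.atom b k x := by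
  rw [Gen.below, Finset.sum_insertNone, Finset.sum_product]
  simp only [coeff_none, atom_none]
  rfl

theorem gen_hasFastDecay (b : Gen d) : HasFastDecay r (W.gen b) := by
  cases b with
  | none => exact W.decay_φ
  | some a => exact W.decay_ψ a.2

theorem atom_continuous (b : Gen d) (k : Fin d → ℤ) : Continuous (W.atom b k) :=
  (W.gen_hasFastDecay b).1.continuous.comp ((continuous_const_smul _).sub continuous_const)

theorem atom_integrable (b : Gen d) (k : Fin d → ℤ) : Integrable (W.atom b k) :=
  ((W.gen_hasFastDecay b).integrable.comp_sub_right _).comp_smul (by positivity)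

/-- A common bound for the lattice sums and the integrals of the finitely many functions `φ` and
`ψ i`. -/
theorem exists_gen_bound : ∃ A : ℝ≥0, ∀ b : Gen d,
    (∀ x, ∑' k : Fin d → ℤ, ‖W.gen b (x - latticePoint k)‖ₑ ≤ A) ∧ ∫⁻ x, ‖W.gen b x‖ₑ ≤ A := by
  have h1 : ∀ b : Gen d, ∃ A : ℝ≥0,
      (∀ x, ∑' k : Fin d → ℤ, ‖W.gen b (x - latticePoint k)‖ₑ ≤ A) ∧
        ∫⁻ x, ‖W.gen b x‖ₑ ≤ A := fun b => by
    obtain ⟨A, hA⟩ := (W.gen_hasFastDecay b).exists_tsum_le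
    have hI : ∫⁻ x, ‖W.gen b x‖ₑ < ∞ := (W.gen_hasFastDecay b).integrable.2
    refine ⟨A + (∫⁻ x, ‖W.gen b x‖ₑ).toNNReal, fun x => (hA x).trans ?_, ?_⟩
    · exact_mod_cast le_self_add
    · rw [ENNReal.coe_add, ENNReal.coe_toNNReal hI.ne]
      exact le_add_self
  choose A hA using h1
  refine ⟨A none + ∑ i, A (some (0, i)), fun b => ?_⟩
  have key : ∀ b' : Gen d, W.gen b = W.gen b' → A b' ≤ A none + ∑ i, A (some (0, i)) →
      (∀ x, ∑' k : Fin d → ℤ, ‖W.gen b (x - latticePoint k)‖ₑ ≤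
        (A none + ∑ i, A (some (0, i)) : ℝ≥0)) ∧
      ∫⁻ x, ‖W.gen b x‖ₑ ≤ (A none + ∑ i, A (some (0, i)) : ℝ≥0) := fun b' hb h => by
    rw [hb]
    exact ⟨fun x => ((hA b').1 x).trans (by exact_mod_cast h),
      (hA b').2.trans (by exact_mod_cast h)⟩
  cases b with
  | none => exact key none rfl le_self_add
  | some a =>
    refine key (some (0, a.2)) rfl (le_trans ?_ le_add_self)
    exact Finset.single_le_sum (f := fun i => A (some (0, i))) (fun _ _ => zero_le)
      (Finset.mem_univ a.2)

theorem norm_atom_le {A : ℝ≥0}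
    (hA : ∀ (b : Gen d) x, ∑' k : Fin d → ℤ, ‖W.gen b (x - latticePoint k)‖ₑ ≤ A) (b : Gen d)
    (k : Fin d → ℤ) (x : RSpace d) : ‖W.atom b k x‖ ≤ A := by
  have h : ‖W.atom b k x‖ₑ ≤ A := (ENNReal.le_tsum k).trans (hA b ((2 : ℝ) ^ b.scale • x))
  exact_mod_cast h

theorem dualAtom_eq_conj (b : Gen d) (k : Fin d → ℤ) :
    W.dualAtom b k = fun x => conj ((2 : ℂ) ^ (d * b.scale) * W.atom b k x) := by
  funext x
  simp only [dualAtom, map_mul, map_pow, map_ofNat]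

/-- The factor `2^{dl}` in the coefficients makes the `L¹` norms of the dual atoms independent of
the scale. -/
theorem lintegral_comp_atom (F : ℂ → ℝ≥0∞) (b : Gen d) (k : Fin d → ℤ) :
    ENNReal.ofReal (2 ^ (d * b.scale)) * ∫⁻ x, F (W.atom b k x) = ∫⁻ x, F (W.gen b x) := by
  have h0 : (2 : ℝ) ^ b.scale ≠ 0 := by positivity
  have h1 := (Homeomorph.smulOfNeZero ((2 : ℝ) ^ b.scale) h0).measurableEmbedding.lintegral_map
    (μ := (volume : Measure (RSpace d))) (fun x => F (W.gen b (x - latticePoint k)))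
  have h2 : ∫⁻ x, F (W.gen b (x - latticePoint k)) = ∫⁻ x, F (W.gen b x) :=
    lintegral_sub_right_eq_self (fun x => F (W.gen b x)) _
  have h3 : ∫⁻ x, F (W.atom b k x) = ENNReal.ofReal (2 ^ (d * b.scale))⁻¹ *
      ∫⁻ x, F (W.gen b x) := by
    rw [← h2]
    refine Eq.trans h1.symm ?_
    change ∫⁻ x, _ ∂(Measure.map (fun x : RSpace d => (2 : ℝ) ^ b.scale • x) volume) = _
    rw [Measure.map_addHaar_smul _ h0, lintegral_smul_measure, smul_eq_mul,
      finrank_euclideanSpace_fin, abs_of_pos (by positivity), ← pow_mul, mul_comm d]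
  rw [h3, ← mul_assoc, ← ENNReal.ofReal_mul (by positivity), mul_inv_cancel₀ (by positivity)]
  simp

theorem lintegral_dualAtom (b : Gen d) (k : Fin d → ℤ) :
    ∫⁻ x, ‖W.dualAtom b k x‖ₑ = ∫⁻ x, ‖W.gen b x‖ₑ := by
  rw [← W.lintegral_comp_atom (fun z => ‖z‖ₑ) b k, ← lintegral_const_mul' _ _ ENNReal.ofReal_ne_top]
  refine lintegral_congr fun x => ?_
  rw [dualAtom, enorm_mul, ← ofReal_norm ((2 : ℂ) ^ _), norm_pow, Complex.norm_ofNat,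
    RCLike.enorm_conj]

theorem atom_memLp {q : ℝ≥0∞} (hq : 1 ≤ q) (b : Gen d) (k : Fin d → ℤ) :
    MemLp (W.atom b k) q volume := by
  obtain ⟨A, hA⟩ := W.exists_gen_bound
  exact (W.atom_integrable b k).memLp_of_bounded_of_one_le
    (W.norm_atom_le (fun b => (hA b).1) b k) hq

theorem dualAtom_memLp {q : ℝ≥0∞} (hq : 1 ≤ q) (b : Gen d) (k : Fin d → ℤ) :
    MemLp (W.dualAtom b k) q volume := by
  rw [dualAtom_eq_conj]
  exact ((W.atom_memLp hq b k).const_mul _).star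

/-- The `L^q` norm of a dual atom does not depend on the translation parameter. -/
theorem eLpNorm_dualAtom (q : ℝ≥0∞) (b : Gen d) (k : Fin d → ℤ) :
    eLpNorm (W.dualAtom b k) q volume = eLpNorm (W.dualAtom b 0) q volume := by
  have h1 : W.dualAtom b k =
      W.dualAtom b 0 ∘ fun x => x - ((2 : ℝ) ^ b.scale)⁻¹ • latticePoint k := by
    funext x
    have h0 : (latticePoint (0 : Fin d → ℤ) : RSpace d) = 0 := by ext i; simp [latticePoint]
    simp [dualAtom, atom, h0, smul_sub, smul_smul]
  have hm : AEStronglyMeasurable (W.dualAtom b 0) volume := by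
    rw [dualAtom_eq_conj]
    exact (continuous_const.mul (W.atom_continuous b 0)).star.aestronglyMeasurable
  rw [h1, eLpNorm_comp_measurePreserving hm (measurePreserving_sub_right volume _)]

/-- The coefficient of an atom, as a continuous linear form on `L^p`. -/
def coeffCLM (p : ℝ≥0∞) [hp : Fact (1 ≤ p)] (b : Gen d) (k : Fin d → ℤ) :
    Lp ℂ p (volume : Measure (RSpace d)) →L[ℂ] ℂ :=
  haveI := (ENNReal.HolderConjugate.inv_one_sub_inv' hp.out).symm
  haveI : Fact (1 ≤ (1 - p⁻¹)⁻¹) := ⟨by simp⟩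
  (ContinuousLinearMap.mul ℂ ℂ).lpPairing volume (1 - p⁻¹)⁻¹ p
    ((W.dualAtom_memLp (q := (1 - p⁻¹)⁻¹) (by simp) b k).toLp _)

theorem coeffCLM_apply {p : ℝ≥0∞} [hp : Fact (1 ≤ p)] (b : Gen d) (k : Fin d → ℤ)
    (f : Lp ℂ p (volume : Measure (RSpace d))) : W.coeffCLM p b k f = W.coeff f b k := by
  rw [coeffCLM, ContinuousLinearMap.lpPairing_eq_integral]
  refine integral_congr_ae ?_
  filter_upwards [(W.dualAtom_memLp (q := (1 - p⁻¹)⁻¹) (by simp) b k).coeFn_toLp] with x hx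
  simp [hx]

theorem exists_norm_coeff_le (p : ℝ≥0∞) [hp : Fact (1 ≤ p)] (b : Gen d) :
    ∃ K : ℝ, ∀ (f : Lp ℂ p (volume : Measure (RSpace d))) (k : Fin d → ℤ),
      ‖W.coeff f b k‖ ≤ K * ‖f‖ := by
  have := (ENNReal.HolderConjugate.inv_one_sub_inv' hp.out).symm
  have : Fact (1 ≤ (1 - p⁻¹)⁻¹) := ⟨by simp⟩
  refine ⟨‖(ContinuousLinearMap.mul ℂ ℂ).lpPairing (volume : Measure (RSpace d)) (1 - p⁻¹)⁻¹ p‖ *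
    (eLpNorm (W.dualAtom b 0) (1 - p⁻¹)⁻¹ volume).toReal, fun f k => ?_⟩
  rw [← coeffCLM_apply, coeffCLM]
  refine (ContinuousLinearMap.le_opNorm₂ _ _ _).trans (le_of_eq ?_)
  rw [Lp.norm_toLp, eLpNorm_dualAtom]

theorem coeff_sub {p : ℝ≥0∞} [Fact (1 ≤ p)] (f g : Lp ℂ p (volume : Measure (RSpace d)))
    (b : Gen d) (k : Fin d → ℤ) : W.coeff ⇑(f - g) b k = W.coeff f b k - W.coeff g b k := by
  simp only [← coeffCLM_apply, map_sub]

/-! ### Size of the partial reconstructions -/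

theorem summable_mul_atom {A : ℝ≥0}
    (hA : ∀ (b : Gen d) x, ∑' k : Fin d → ℤ, ‖W.gen b (x - latticePoint k)‖ₑ ≤ A) (b : Gen d)
    (x : RSpace d) {c : (Fin d → ℤ) → ℂ} {M : ℝ} (hc : ∀ k, ‖c k‖ ≤ M) :
    Summable (fun k => c k * W.atom b k x) ∧ ‖∑' k, c k * W.atom b k x‖ ≤ M * A := by
  have hM : 0 ≤ M := (norm_nonneg _).trans (hc 0)
  have h1 : ∑' k : Fin d → ℤ, ‖W.atom b k x‖ₑ ≤ A := hA b _
  have h2 : Summable fun k : Fin d → ℤ => ‖W.atom b k x‖₊ :=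
    ENNReal.tsum_coe_ne_top_iff_summable.1 (h1.trans_lt ENNReal.coe_lt_top).ne
  have h3 : ∑' k : Fin d → ℤ, ‖W.atom b k x‖₊ ≤ A := by
    have h4 := ENNReal.coe_tsum h2
    rw [← ENNReal.coe_le_coe, h4]
    exact h1
  have h5 : Summable fun k : Fin d → ℤ => ‖W.atom b k x‖ := NNReal.summable_coe.2 h2
  have h6 : ∑' k : Fin d → ℤ, ‖W.atom b k x‖ ≤ A := by
    have := NNReal.coe_le_coe.2 h3
    rwa [NNReal.coe_tsum] at this
  have h7 : ∀ k, ‖c k * W.atom b k x‖ ≤ M * ‖W.atom b k x‖ := fun k => by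
    rw [norm_mul]; gcongr; exact hc k
  refine ⟨Summable.of_norm_bounded (h5.mul_left M) h7, ?_⟩
  refine (tsum_of_norm_bounded (h5.mul_left M).hasSum h7).trans ?_
  rw [tsum_mul_left]
  gcongr

theorem card_below (j : ℕ) : (Gen.below d j).card = j * (2 ^ d - 1) + 1 := by
  simp [Gen.below]

/-- The coefficients of each generator are assumed bounded so that the series over `ℤ^d` converge
absolutely and can be subtracted term by term. -/
theorem norm_partialSum_sub_le {A : ℝ≥0}
    (hA : ∀ (b : Gen d) x, ∑' k : Fin d → ℤ, ‖W.gen b (x - latticePoint k)‖ₑ ≤ A)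
    {f g : RSpace d → ℂ} {M : ℝ} (j : ℕ)
    (hf : ∀ b, ∃ M, ∀ k, ‖W.coeff f b k‖ ≤ M) (hg : ∀ b, ∃ M, ∀ k, ‖W.coeff g b k‖ ≤ M)
    (h : ∀ b ∈ Gen.below d j, ∀ k, ‖W.coeff f b k - W.coeff g b k‖ ≤ M) (x : RSpace d) :
    ‖W.partialSum f j x - W.partialSum g j x‖ ≤ (j * (2 ^ d - 1) + 1 : ℕ) * (M * A) := by
  rw [partialSum_eq, partialSum_eq, ← Finset.sum_sub_distrib, ← card_below, ← nsmul_eq_mul]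
  refine (norm_sum_le _ _).trans (Finset.sum_le_card_nsmul _ _ _ fun b hb => ?_)
  obtain ⟨M1, h1⟩ := hf b
  obtain ⟨M2, h2⟩ := hg b
  rw [← (W.summable_mul_atom hA b x h1).1.tsum_sub (W.summable_mul_atom hA b x h2).1]
  simp only [← sub_mul]
  exact (W.summable_mul_atom hA b x (h b hb)).2

/-- Bounded coefficients give linear growth in `j`, since `P_j` has `(2^d - 1) j + 1` generators. -/
theorem norm_partialSum_le {A : ℝ≥0}
    (hA : ∀ (b : Gen d) x, ∑' k : Fin d → ℤ, ‖W.gen b (x - latticePoint k)‖ₑ ≤ A)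
    {f : RSpace d → ℂ} {M : ℝ} (h : ∀ b k, ‖W.coeff f b k‖ ≤ M) (j : ℕ) (x : RSpace d) :
    ‖W.partialSum f j x‖ ≤ (j * (2 ^ d - 1) + 1 : ℕ) * (M * A) := by
  rw [partialSum_eq, ← card_below, ← nsmul_eq_mul]
  refine (norm_sum_le _ _).trans (Finset.sum_le_card_nsmul _ _ _ fun b _ => ?_)
  exact (W.summable_mul_atom hA b x (h b)).2

end WaveletSystem

/-! ### The topology of a space given by an extended norm -/

namespace ExtendedNorm

variable {G : Type*} [AddCommGroup G] {N : ExtendedNorm G}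

theorem Space.norm_def (f : N.Space) : ‖f‖ = (N.toFun f.val).toReal := rfl

theorem Space.val_sub (f g : N.Space) : (f - g).val = f.val - g.val := rfl

theorem Space.toFun_val_lt_top (f : N.Space) : N.toFun f.val < ∞ := f.2

theorem Space.ofReal_norm (f : N.Space) : ENNReal.ofReal ‖f‖ = N.toFun f.val := by
  rw [Space.norm_def, ENNReal.ofReal_toReal f.toFun_val_lt_top.ne]

/-- The element of the space with a given underlying element of finite norm. -/
def Space.mk (f : G) (hf : N.toFun f < ∞) : N.Space := ⟨f, hf⟩

theorem Space.val_mk (f : G) (hf : N.toFun f < ∞) : (Space.mk f hf : N.Space).val = f := rfl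

theorem exists_toFun_sub_le_of_cauchySeq {u : ℕ → N.Space} (hu : CauchySeq u) {ε : ℝ≥0∞}
    (hε : 0 < ε) : ∃ n₀, ∀ n ≥ n₀, ∀ m ≥ n₀, N.toFun ((u n).val - (u m).val) ≤ ε := by
  obtain ⟨δ, h1, h2⟩ := ENNReal.lt_iff_exists_real_btwn.1 hε
  obtain ⟨n₀, hn₀⟩ := Metric.cauchySeq_iff.1 hu δ (ENNReal.ofReal_pos.1 h2.1)
  refine ⟨n₀, fun n hn m hm => ?_⟩
  have h3 := hn₀ n hn m hm
  rw [dist_eq_norm] at h3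
  rw [← Space.val_sub, ← Space.ofReal_norm]
  exact (ENNReal.ofReal_le_ofReal h3.le).trans h2.2.le

theorem dense_of_tendsto {S : Set G} (h : ∀ f : N.Space, ∃ g : ℕ → G,
    Tendsto (fun n => N.toFun (f.val - g n)) atTop (𝓝 0) ∧ ∀ n, g n ∈ S) :
    Dense {f : N.Space | f.val ∈ S} := by
  refine Metric.dense_iff.2 fun f ε hε => ?_
  obtain ⟨g, h1, hS⟩ := h f
  obtain ⟨n, hn⟩ := (h1.eventually (gt_mem_nhds (ENNReal.ofReal_pos.2 hε))).exists
  have hfin : N.toFun (g n) < ∞ := by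
    have h3 : g n = f.val + -(f.val - g n) := by abel
    rw [h3]
    refine (N.map_add_le _ _).trans_lt (ENNReal.add_lt_top.2 ⟨f.toFun_val_lt_top, ?_⟩)
    rw [N.map_neg]
    exact hn.trans ENNReal.ofReal_lt_top
  refine ⟨.mk _ hfin, ?_, hS n⟩
  rw [Metric.mem_ball, dist_comm, dist_eq_norm, Space.norm_def, Space.val_sub, Space.val_mk]
  exact (ENNReal.lt_ofReal_iff_toReal_lt hn.ne_top).1 hn

end ExtendedNorm

/-! ### Genericity of slowly growing partial reconstructions -/

theorem tendsto_posLog_one_add_sq_div :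
    Tendsto (fun j : ℕ => Real.posLog ((1 + (j : ℝ)) ^ 2) / (j * Real.log 2)) atTop (𝓝 0) := by
  have h1 : Tendsto (fun j : ℕ => Real.log (1 + (j : ℝ)) / (1 + (j : ℝ))) atTop (𝓝 0) :=
    Real.isLittleO_log_id_atTop.tendsto_div_nhds_zero.comp
      (tendsto_const_nhds.add_atTop tendsto_natCast_atTop_atTop)
  have h2 := h1.const_mul (4 / Real.log 2)
  rw [mul_zero] at h2
  have hl : 0 < Real.log 2 := Real.log_pos (by norm_num)
  refine squeeze_zero' (Eventually.of_forall fun j => ?_) ?_ h2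
  · exact div_nonneg Real.posLog_nonneg (by positivity)
  filter_upwards [eventually_ge_atTop 1] with j hj
  have hj' : (1 : ℝ) ≤ j := by exact_mod_cast hj
  rw [Real.posLog_eq_log (by rw [abs_of_pos (by positivity)]; nlinarith), Real.log_pow]
  have h3 : 0 ≤ Real.log (1 + (j : ℝ)) := Real.log_nonneg (by linarith)
  rw [div_mul_div_comm, div_le_div_iff₀ (by positivity) (by positivity)]
  push_cast
  nlinarith [mul_nonneg h3 (mul_nonneg hl.le (by linarith : (0 : ℝ) ≤ j - 1))]

namespace WaveletSystem

variable {d r : ℕ} (W : WaveletSystem d r) {p : ℝ≥0∞}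
  (N : ExtendedNorm (Lp ℂ p (volume : Measure (RSpace d))))

/-- The elements of the space all of whose coefficients are bounded by a common constant. -/
def tameSet : Set N.Space := {f | ∃ M : ℝ, ∀ b k, ‖W.coeff f.val b k‖ ≤ M}

/-- The elements for which, for some `j ≥ n`, the function `P_j f` is at most `(1 + j)^2`. -/
def slowSet (n : ℕ) : Set N.Space :=
  {f | ∃ j ≥ n, ∀ x, ‖W.partialSum f.val j x‖ ≤ (1 + (j : ℝ)) ^ 2}

variable {N}

theorem frequently_posLog_le {f : N.Space} (hf : ∀ n, f ∈ W.slowSet N n) (x : RSpace d) {ε : ℝ}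
    (hε : 0 < ε) :
    ∃ᶠ j : ℕ in atTop, Real.posLog ‖W.partialSum f.val j x‖ / (j * Real.log 2) ≤ ε := by
  have h1 : ∃ᶠ j : ℕ in atTop, ‖W.partialSum f.val j x‖ ≤ (1 + (j : ℝ)) ^ 2 :=
    frequently_atTop.2 fun n => by
      obtain ⟨j, hj, h⟩ := hf n
      exact ⟨j, hj, h x⟩
  refine (h1.and_eventually (tendsto_posLog_one_add_sq_div.eventually (ge_mem_nhds hε))).mono ?_
  rintro j ⟨h2, h3⟩
  refine le_trans ?_ h3
  have hl : 0 < Real.log 2 := Real.log_pos (by norm_num)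
  have h4 := Real.posLog_le_posLog (norm_nonneg _) h2
  gcongr

theorem liminf_posLog_eq_zero {f : N.Space} (hf : ∀ n, f ∈ W.slowSet N n) (x : RSpace d) :
    liminf (fun j : ℕ =>
      ((Real.posLog ‖W.partialSum f.val j x‖ / (j * Real.log 2) : ℝ) : EReal)) atTop = 0 := by
  have hl : 0 < Real.log 2 := Real.log_pos (by norm_num)
  refine le_antisymm (le_of_forall_gt fun c hc => ?_) ?_
  · obtain ⟨ε, h1, h2⟩ := EReal.lt_iff_exists_real_btwn.1 hc
    refine lt_of_le_of_lt (liminf_le_of_frequently_le' ?_) h2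
    refine (W.frequently_posLog_le hf x (ε := ε) (by exact_mod_cast h1)).mono fun j hj => ?_
    exact_mod_cast hj
  · refine le_liminf_of_le (by isBoundedDefault) (Eventually.of_forall fun j => ?_)
    exact_mod_cast div_nonneg Real.posLog_nonneg (by positivity)

theorem divergenceSet_eq_empty {f : N.Space} (hf : ∀ n, f ∈ W.slowSet N n) {β : ℝ} (hβ : 0 < β) :
    W.divergenceSet β f.val = ∅ := by
  refine Set.eq_empty_of_forall_notMem fun x hx => ?_
  have hl : 0 < Real.log 2 := Real.log_pos (by norm_num)
  have h1 := W.frequently_posLog_le hf x (half_pos hβ)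
  have h2 : ∀ᶠ j : ℕ in atTop, β / 2 < Real.log ‖W.partialSum f.val j x‖ / (j * Real.log 2) :=
    Tendsto.eventually hx (lt_mem_nhds (half_lt_self hβ))
  obtain ⟨j, h3, h4⟩ := (h1.and_eventually h2).exists
  refine absurd (h4.trans_le (le_trans ?_ h3)) (lt_irrefl _)
  gcongr
  exact le_max_right _ _

/-- On the generic set the divergence sets are empty, so that their dimension is `0` instead of
the positive number `d - sp - βp`. -/
theorem not_isStronglyMultifractal {f : N.Space} (hf : ∀ n, f ∈ W.slowSet N n) {s P : ℝ}
    (hP : 0 < P) (hsP : s * P < d) : ¬ W.IsStronglyMultifractal s P f.val := by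
  intro h
  have h0 : 0 < d / P - s := by
    rw [sub_pos, lt_div_iff₀ hP]
    exact hsP
  obtain ⟨h1, -⟩ := h ((d / P - s) / 2) (half_pos h0) (half_le_self h0.le)
  rw [W.divergenceSet_eq_empty hf (half_pos h0), dimH_empty] at h1
  have h2 : 0 < d - s * P - (d / P - s) / 2 * P := by
    have : d - s * P - (d / P - s) / 2 * P = (d - s * P) / 2 := by field_simp; ring
    rw [this]
    linarith
  exact (ENNReal.ofReal_pos.2 h2).ne h1

variable [Fact (1 ≤ p)]

/-- If the coefficients of each scale depend continuously on `f`, then every element with bounded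
coefficients, whose partial reconstructions grow linearly, has a neighbourhood of elements with
`|P_j| ≤ (1 + j)^2` for some large `j`. -/
theorem tameSet_subset_interior_slowSet
    (hb : ∀ b, ∃ K : ℝ, ∀ (f : N.Space) k, ‖W.coeff f.val b k‖ ≤ K * ‖f‖) (n : ℕ) :
    W.tameSet N ⊆ interior (W.slowSet N n) := by
  rintro f ⟨M, hM⟩
  obtain ⟨A, hA⟩ := W.exists_gen_bound
  have hA1 := fun b => (hA b).1
  choose K hK using hb
  have hM0 : 0 ≤ M := (norm_nonneg _).trans (hM none 0)
  obtain ⟨j, hj⟩ := exists_nat_ge ((n : ℝ) + 2 ^ d * (M * A) + 2 ^ d * A + 1)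
  have hMA : 0 ≤ (M * A : ℝ) := by positivity
  have hc : ((j * (2 ^ d - 1) + 1 : ℕ) : ℝ) ≤ 2 ^ d * (1 + j) := by
    have h2 : (1 : ℕ) ≤ 2 ^ d := Nat.one_le_two_pow
    push_cast [Nat.cast_sub h2]
    have h3 : (1 : ℝ) ≤ 2 ^ d := by exact_mod_cast h2
    nlinarith [(Nat.cast_nonneg j : (0 : ℝ) ≤ j)]
  have hpos : (0 : ℝ) ≤ 2 ^ d * (M * A) := by positivity
  have hpos' : (0 : ℝ) ≤ 2 ^ d * A := by positivity
  have hn : (n : ℝ) ≤ j := by linarith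
  -- the finitely many generators below `j` have a common bound `L`
  set L : ℝ := ∑ b ∈ Gen.below d j, |K b| with hL
  have hL0 : 0 ≤ L := Finset.sum_nonneg fun _ _ => abs_nonneg _
  refine mem_interior.2 ⟨Metric.ball f (1 / (L + 1)), fun g hg => ⟨j, by exact_mod_cast hn,
    fun x => ?_⟩, Metric.isOpen_ball, Metric.mem_ball_self (by positivity)⟩
  have hgf : ‖g - f‖ < 1 / (L + 1) := by rwa [← dist_eq_norm]
  have h1 : ∀ b ∈ Gen.below d j, ∀ k, ‖W.coeff g.val b k - W.coeff f.val b k‖ ≤ 1 := by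
    intro b hb k
    have h2 := hK b (g - f) k
    rw [ExtendedNorm.Space.val_sub, coeff_sub] at h2
    have h3 : K b ≤ L := (le_abs_self _).trans
      (Finset.single_le_sum (f := fun b => |K b|) (fun _ _ => abs_nonneg _) hb)
    refine h2.trans ?_
    calc K b * ‖g - f‖ ≤ (L + 1) * (1 / (L + 1)) := by
          gcongr
          linarith
      _ = 1 := by field_simp
  have h4 := W.norm_partialSum_sub_le hA1 j (fun b => ⟨_, hK b g⟩) (fun b => ⟨_, hK b f⟩) h1 x
  have h5 := W.norm_partialSum_le hA1 hM j x
  have h6 : ‖W.partialSum g.val j x‖ ≤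
      ‖W.partialSum g.val j x - W.partialSum f.val j x‖ + ‖W.partialSum f.val j x‖ := by
    simpa using norm_add_le (W.partialSum g.val j x - W.partialSum f.val j x)
      (W.partialSum f.val j x)
  have h7 : ((j * (2 ^ d - 1) + 1 : ℕ) : ℝ) * (M * A) + ((j * (2 ^ d - 1) + 1 : ℕ) : ℝ) * (1 * A)
      ≤ (2 ^ d * (1 + j)) * (M * A) + (2 ^ d * (1 + j)) * (1 * A) := by gcongr
  have hn0 : (0 : ℝ) ≤ n := Nat.cast_nonneg n
  nlinarith

/-- The dense `G_δ` set is the intersection of the interiors of the sets `slowSet n`. It contains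
the dense set of elements with bounded coefficients, so that its density does not need the Baire
property, which serves only for the last assertion. -/
theorem generic_of_dense_tameSet
    (hb : ∀ b, ∃ K : ℝ, ∀ (f : N.Space) k, ‖W.coeff f.val b k‖ ≤ K * ‖f‖)
    (hd : Dense (W.tameSet N)) (s : ℝ) (hp : p ≠ ∞) :
    (∃ R : Set N.Space, R ∈ residual N.Space ∧ IsGδ R ∧ Dense R ∧ ∀ f ∈ R, ∀ x : RSpace d,
      liminf (fun j : ℕ =>
        ((Real.posLog ‖W.partialSum f.val j x‖ / (j * Real.log 2) : ℝ) : EReal)) atTop = 0) ∧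
    (s * p.toReal < d →
      IsMeagre {f : N.Space | W.IsStronglyMultifractal s p.toReal f.val} ∧
      (BaireSpace N.Space →
        {f : N.Space | W.IsStronglyMultifractal s p.toReal f.val} ∉ residual N.Space)) := by
  have hp1 : 1 ≤ p := Fact.out
  have hsub : W.tameSet N ⊆ ⋂ n, interior (W.slowSet N n) :=
    Set.subset_iInter fun n => W.tameSet_subset_interior_slowSet hb n
  have hslow : ∀ f ∈ ⋂ n, interior (W.slowSet N n), ∀ n, f ∈ W.slowSet N n := fun f hf n =>
    interior_subset (Set.mem_iInter.1 hf n)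
  have hres : (⋂ n, interior (W.slowSet N n)) ∈ residual N.Space :=
    countable_iInter_mem.2 fun n => residual_of_dense_open isOpen_interior
      (hd.mono (W.tameSet_subset_interior_slowSet hb n))
  refine ⟨⟨⋂ n, interior (W.slowSet N n), hres, .iInter_of_isOpen fun n => isOpen_interior,
    hd.mono hsub, fun f hf => W.liminf_posLog_eq_zero (hslow f hf)⟩, fun hsp => ?_⟩
  have hcompl : {f : N.Space | W.IsStronglyMultifractal s p.toReal f.val}ᶜ ∈ residual N.Space := by
    refine mem_of_superset hres fun f hf => ?_
    exact W.not_isStronglyMultifractal (hslow f hf)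
      (ENNReal.toReal_pos (zero_lt_one.trans_le hp1).ne' hp) hsp
  refine ⟨hcompl, fun hB hS => ?_⟩
  have h1 := inter_mem hS hcompl
  rw [Set.inter_compl_self] at h1
  exact Set.not_nonempty_empty (dense_of_mem_residual h1).nonempty

end WaveletSystem

/-! ### A completeness criterion -/

/-- Completeness may be tested on a dense subgroup on which the norm dominates the norm of the
ambient group: the limit is then found in the ambient group, and the assumption `hlim` says that
it is a limit in the space. -/
theorem ExtendedNorm.completeSpace_of_dense {G : Type*} [NormedAddCommGroup G] [CompleteSpace G]
    {N : ExtendedNorm G} (D : AddSubgroup G) (hD : Dense {f : N.Space | f.val ∈ D})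
    {C : ℝ} (hC : ∀ f : N.Space, f.val ∈ D → ‖f.val‖ ≤ C * ‖f‖)
    (hlim : ∀ (u : ℕ → N.Space) (g : G), CauchySeq u → Tendsto (fun n => (u n).val) atTop (𝓝 g) →
      Tendsto (fun n => N.toFun ((u n).val - g)) atTop (𝓝 0)) :
    CompleteSpace N.Space := by
  refine Metric.complete_of_cauchySeq_tendsto fun v hv => ?_
  have h1 : ∀ n : ℕ, ∃ w : N.Space, w.val ∈ D ∧ dist (v n) w < 1 / ((n : ℝ) + 1) := fun n => by
    obtain ⟨w, hw, h⟩ := hD.exists_dist_lt (v n) (ε := 1 / ((n : ℝ) + 1)) (by positivity)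
    exact ⟨w, hw, h⟩
  choose u huD hu using h1
  have h0 : Tendsto (fun n => dist (v n) (u n)) atTop (𝓝 0) :=
    squeeze_zero (fun n => dist_nonneg) (fun n => (hu n).le)
      tendsto_one_div_add_atTop_nhds_zero_nat
  have hcu : CauchySeq u := by
    refine Metric.cauchySeq_iff.2 fun ε hε => ?_
    obtain ⟨n1, h1⟩ := Metric.cauchySeq_iff.1 hv (ε / 3) (by positivity)
    obtain ⟨n2, h2⟩ := eventually_atTop.1 (h0.eventually (gt_mem_nhds (div_pos hε three_pos)))
    refine ⟨max n1 n2, fun m hm n hn => ?_⟩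
    have a1 := h1 m (le_of_max_le_left hm) n (le_of_max_le_left hn)
    have a2 := h2 m (le_of_max_le_right hm)
    have a3 := h2 n (le_of_max_le_right hn)
    have a4 := dist_triangle4 (u m) (v m) (v n) (u n)
    rw [dist_comm (u m) (v m)] at a4
    linarith
  have hcg : CauchySeq fun n => (u n).val := by
    refine Metric.cauchySeq_iff.2 fun ε hε => ?_
    obtain ⟨n1, h1⟩ := Metric.cauchySeq_iff.1 hcu (ε / (|C| + 1)) (by positivity)
    refine ⟨n1, fun m hm n hn => ?_⟩
    have a1 := h1 m hm n hn
    rw [dist_eq_norm] at a1 ⊢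
    have a2 := hC (u m - u n) (D.sub_mem (huD m) (huD n))
    rw [ExtendedNorm.Space.val_sub] at a2
    calc _ ≤ C * ‖u m - u n‖ := a2
      _ ≤ (|C| + 1) * ‖u m - u n‖ := by
          gcongr
          exact (le_abs_self C).trans (by linarith)
      _ < (|C| + 1) * (ε / (|C| + 1)) := by gcongr
      _ = ε := by field_simp
  obtain ⟨g, hg⟩ := cauchySeq_tendsto_of_complete hcg
  have h2 := hlim u g hcu hg
  have hfin : N.toFun g < ∞ := by
    obtain ⟨n, hn⟩ := (h2.eventually (gt_mem_nhds zero_lt_one)).exists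
    have h3 : g = (u n).val + -((u n).val - g) := by abel
    rw [h3]
    refine (N.map_add_le _ _).trans_lt (ENNReal.add_lt_top.2 ⟨(u n).toFun_val_lt_top, ?_⟩)
    rw [N.map_neg]
    exact hn.trans ENNReal.one_lt_top
  refine ⟨Space.mk g hfin, ?_⟩
  have h3 : Tendsto u atTop (𝓝 (Space.mk g hfin)) := by
    refine tendsto_iff_dist_tendsto_zero.2 ?_
    simp only [dist_eq_norm, Space.norm_def, Space.val_sub, Space.val_mk]
    simpa only [ENNReal.toReal_zero, Function.comp_def] using
      (ENNReal.tendsto_toReal ENNReal.zero_ne_top).comp h2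
  exact (tendsto_iff_of_dist h0).2 h3

/-! ### Biorthogonality of the atoms and the dual atoms -/

namespace WaveletSystem

variable {d r : ℕ} (W : WaveletSystem d r)

/-- Wavelets of scale `l ≥ 0` are orthogonal to `V l`: for `l = 0` this is the assumption, and the
dilation axiom transports it from `V l` to `V (l + 1)`. -/
theorem integral_conj_wavelet_mul_eq_zero (i : Fin (2 ^ d - 1)) (k : Fin d → ℤ) (l : ℕ) :
    ∀ h ∈ W.V l, ∫ x, conj (W.atom (some (l, i)) k x) * h x = 0 := by
  induction l with
  | zero =>
    intro h hh
    obtain ⟨e, he, -, -, hV⟩ := W.isWaveletBasis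
    have h1 := (Submodule.mem_orthogonal _ _).1 (Submodule.mem_inf.1 (hV i k)).2 h hh
    rw [← inner_conj_symm, map_eq_zero, L2.inner_def] at h1
    rw [← h1]
    refine integral_congr_ae ?_
    filter_upwards [he i 0 k] with x hx
    simp [hx, atom, gen, Gen.scale, mul_comm]
  | succ l ih =>
    intro h hh
    have h0 : ((2 : ℝ)⁻¹) ≠ 0 := by norm_num
    have hm : MemLp (fun x => h ((2 : ℝ)⁻¹ • x)) 2 (volume : Measure (RSpace d)) := by
      refine ((Homeomorph.smulOfNeZero ((2 : ℝ)⁻¹) h0).measurableEmbedding.memLp_map_measure_iff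
        (g := h)).1 ?_
      change MemLp h 2 (Measure.map (fun x : RSpace d => (2 : ℝ)⁻¹ • x) volume)
      rw [Measure.map_addHaar_smul _ h0]
      exact (Lp.memLp h).smul_measure ENNReal.ofReal_ne_top
    have hq : Tendsto (fun x : RSpace d => (2 : ℝ) • x) (ae volume) (ae volume) :=
      Measure.QuasiMeasurePreserving.tendsto_ae ⟨measurable_const_smul _, by
        rw [Measure.map_addHaar_smul _ (two_ne_zero (α := ℝ))]
        exact Measure.smul_absolutelyContinuous⟩
    have h1 : h =ᵐ[volume] fun x => hm.toLp _ ((2 : ℝ) • x) := by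
      filter_upwards [hq.eventually hm.coeFn_toLp] with x hx
      rw [hx, smul_smul]
      norm_num
    have h2 : hm.toLp _ ∈ W.V l := by
      refine (W.isMRA.dilation l (hm.toLp _) h h1).2 ?_
      exact_mod_cast hh
    have h3 := ih _ h2
    have h4 := Measure.integral_comp_smul (volume : Measure (RSpace d))
      (fun y => conj (W.atom (some (l, i)) k y) * hm.toLp _ y) (2 : ℝ)
    rw [h3, smul_zero] at h4
    rw [← h4]
    refine integral_congr_ae ?_
    filter_upwards [h1] with x hx
    rw [hx]
    simp [atom, Gen.scale, gen, pow_succ, smul_smul]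

theorem V_zero_le (l : ℕ) : W.V 0 ≤ W.V l := by
  induction l with
  | zero => exact le_rfl
  | succ l ih => exact ih.trans (by exact_mod_cast W.isMRA.mono l)

open Classical in
theorem integral_conj_atom_mul_atom (b b' : Gen d) (k k' : Fin d → ℤ) :
    ((2 : ℝ) ^ ((d : ℝ) * b.scale / 2) * (2 : ℝ) ^ ((d : ℝ) * b'.scale / 2) : ℝ) *
      ∫ x, conj (W.atom b k x) * W.atom b' k' x = if (b, k) = (b', k') then 1 else 0 := by
  obtain ⟨e, he, heo, heV⟩ := W.isMRA.basis
  obtain ⟨e', he', heo', -, -⟩ := W.isWaveletBasis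
  have hmem : ∀ k, e k ∈ W.V 0 := fun k => by
    rw [← heV]
    exact Submodule.le_topologicalClosure _ (Submodule.subset_span ⟨k, rfl⟩)
  have hcross : ∀ (a : ℕ × Fin (2 ^ d - 1)) k k',
      ∫ x, conj (W.atom (some a) k x) * W.atom none k' x = 0 := fun a k k' => by
    rw [← W.integral_conj_wavelet_mul_eq_zero a.2 k a.1 (e k') (W.V_zero_le _ (hmem k'))]
    refine integral_congr_ae ?_
    filter_upwards [he k'] with x hx
    rw [hx, atom_none]
  cases b with
  | none =>
    cases b' with
    | none =>
      have h1 := orthonormal_iff_ite.1 heo k k'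
      rw [L2.inner_def] at h1
      have h2 : ∫ x, conj (W.atom none k x) * W.atom none k' x = if k = k' then 1 else 0 := by
        rw [← h1]
        refine integral_congr_ae ?_
        filter_upwards [he k, he k'] with x hx hx'
        simp [hx, hx', atom_none, mul_comm]
      simp [h2, Gen.scale]
    | some a =>
      have h2 : ∫ x, conj (W.atom none k x) * W.atom (some a) k' x = 0 := by
        have h3 := congrArg conj (hcross a k' k)
        rw [← integral_conj, map_zero] at h3
        rw [← h3]
        refine integral_congr_ae (Eventually.of_forall fun x => ?_)
        simp [mul_comm]
      simp [h2]
  | some a =>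
    cases b' with
    | none => simp [hcross]
    | some a' =>
      have h1 := orthonormal_iff_ite.1 heo' (a.2, (a.1 : ℤ), k) (a'.2, (a'.1 : ℤ), k')
      have h3 : ((a.2, (a.1 : ℤ), k) = (a'.2, (a'.1 : ℤ), k')) ↔
          ((some a, k) = (some a', k')) := by
        simp [Prod.ext_iff, and_assoc, and_left_comm]
      rw [L2.inner_def] at h1
      simp only [h3] at h1
      rw [← h1, ← integral_const_mul]
      refine integral_congr_ae ?_
      filter_upwards [he' a.2 a.1 k, he' a'.2 a'.1 k'] with x hx hx'
      rw [hx, hx']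
      simp [atom, gen, Gen.scale]
      ring

open Classical in
theorem coeff_atom (b b' : Gen d) (k k' : Fin d → ℤ) :
    W.coeff (W.atom b' k') b k = if (b, k) = (b', k') then 1 else 0 := by
  have h1 := W.integral_conj_atom_mul_atom b b' k k'
  have h2 : W.coeff (W.atom b' k') b k =
      (2 : ℂ) ^ (d * b.scale) * ∫ x, conj (W.atom b k x) * W.atom b' k' x := by
    rw [coeff, ← integral_const_mul]
    simp only [dualAtom, mul_assoc]
  rw [h2]
  split_ifs at h1 ⊢ with h
  · obtain ⟨rfl, rfl⟩ := Prod.ext_iff.1 h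
    rw [← h1]
    congr 1
    rw [← Real.rpow_add (by norm_num), add_halves]
    have : ((d : ℝ) * b.scale) = ((d * b.scale : ℕ) : ℝ) := by push_cast; rfl
    rw [this, Real.rpow_natCast]
    push_cast
    rfl
  · refine mul_eq_zero_of_right _ ((mul_eq_zero.1 h1).resolve_left ?_)
    exact Complex.ofReal_ne_zero.2 (by positivity)

/-! ### Finite combinations of atoms -/

variable (p : ℝ≥0∞) [Fact (1 ≤ p)]

/-- An atom, as an element of `L^p`. -/
def atomLp (b : Gen d) (k : Fin d → ℤ) : Lp ℂ p (volume : Measure (RSpace d)) :=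
  (W.atom_memLp (q := p) Fact.out b k).toLp _

open Classical in
theorem coeffCLM_atomLp (b b' : Gen d) (k k' : Fin d → ℤ) :
    W.coeffCLM p b k (W.atomLp p b' k') = if (b, k) = (b', k') then 1 else 0 := by
  rw [coeffCLM_apply, ← coeff_atom]
  refine integral_congr_ae ?_
  filter_upwards [(W.atom_memLp (q := p) Fact.out b' k').coeFn_toLp] with x hx
  rw [atomLp, hx]

/-- The finite combinations of atoms. -/
def atomSpan : Submodule ℂ (Lp ℂ p (volume : Measure (RSpace d))) :=
  Submodule.span ℂ (Set.range fun a : Gen d × (Fin d → ℤ) => W.atomLp p a.1 a.2)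

/-- The lattice points in the cube of side `2n` about the origin. -/
def box (d n : ℕ) : Finset (Fin d → ℤ) := Fintype.piFinset fun _ => Finset.Icc (-(n : ℤ)) n

theorem eventually_mem_box (k : Fin d → ℤ) : ∀ᶠ n in atTop, k ∈ box d n := by
  filter_upwards [eventually_ge_atTop (∑ i, (k i).natAbs)] with n hn
  refine Fintype.mem_piFinset.2 fun i => Finset.mem_Icc.2 ?_
  have := Finset.single_le_sum (f := fun i => (k i).natAbs) (fun _ _ => Nat.zero_le _)
    (Finset.mem_univ i)
  omega

theorem _root_.Gen.eventually_mem_below (b : Gen d) : ∀ᶠ n in atTop, b ∈ Gen.below d n := by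
  cases b with
  | none => exact Eventually.of_forall fun n => by simp [Gen.below]
  | some a =>
    filter_upwards [eventually_gt_atTop a.1] with n hn
    simp [Gen.below, hn]

/-- The partial sum of the expansion over the finitely many atoms of scale less than `n` whose
translation parameter lies in a box. -/
def trunc (n : ℕ) :
    Lp ℂ p (volume : Measure (RSpace d)) →L[ℂ] Lp ℂ p (volume : Measure (RSpace d)) :=
  ∑ b ∈ Gen.below d n, ∑ k ∈ box d n, (W.coeffCLM p b k).smulRight (W.atomLp p b k)

theorem trunc_apply (n : ℕ) (f : Lp ℂ p (volume : Measure (RSpace d))) :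
    W.trunc p n f = ∑ b ∈ Gen.below d n, ∑ k ∈ box d n, W.coeff f b k • W.atomLp p b k := by
  simp [trunc, coeffCLM_apply]

theorem trunc_mem_atomSpan (n : ℕ) (f : Lp ℂ p (volume : Measure (RSpace d))) :
    W.trunc p n f ∈ W.atomSpan p := by
  rw [trunc_apply]
  exact Submodule.sum_mem _ fun b _ => Submodule.sum_mem _ fun k _ =>
    Submodule.smul_mem _ _ (Submodule.subset_span ⟨(b, k), rfl⟩)

open Classical in
theorem coeff_trunc (n : ℕ) (f : Lp ℂ p (volume : Measure (RSpace d))) (b : Gen d)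
    (k : Fin d → ℤ) : W.coeff (W.trunc p n f) b k =
      if b ∈ Gen.below d n ∧ k ∈ box d n then W.coeff f b k else 0 := by
  rw [← coeffCLM_apply, trunc_apply]
  simp only [map_sum, map_smul, coeffCLM_atomLp, smul_eq_mul, Prod.mk.injEq, ite_and, mul_ite,
    mul_one, mul_zero, Finset.sum_ite_eq, Finset.sum_ite_irrel, Finset.sum_const_zero]

theorem eventually_trunc_eq {f : Lp ℂ p (volume : Measure (RSpace d))} (hf : f ∈ W.atomSpan p) :
    ∀ᶠ n in atTop, W.trunc p n f = f := by
  classical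
  induction hf using Submodule.span_induction with
  | mem x hx =>
    obtain ⟨⟨b, k⟩, rfl⟩ := hx
    filter_upwards [b.eventually_mem_below, eventually_mem_box k] with n h1 h2
    rw [trunc_apply]
    simp only [← coeffCLM_apply, coeffCLM_atomLp, Prod.mk.injEq, ite_and, ite_smul, one_smul,
      zero_smul, Finset.sum_ite_eq', Finset.sum_ite_irrel, Finset.sum_const_zero, h1, h2, if_true]
  | zero => simp
  | add x y _ _ hx hy =>
    filter_upwards [hx, hy] with n h1 h2
    rw [map_add, h1, h2]
  | smul a x _ hx =>
    filter_upwards [hx] with n h1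
    rw [map_smul, h1]

theorem exists_norm_coeff_le_of_mem_atomSpan {f : Lp ℂ p (volume : Measure (RSpace d))}
    (hf : f ∈ W.atomSpan p) : ∃ M : ℝ, ∀ b k, ‖W.coeff f b k‖ ≤ M := by
  classical
  obtain ⟨n, hn⟩ := (W.eventually_trunc_eq p hf).exists
  have h0 : ∀ b ∈ Gen.below d n, ∀ k ∈ box d n, ‖W.coeff f b k‖ ≤
      ∑ b ∈ Gen.below d n, ∑ k ∈ box d n, ‖W.coeff f b k‖ := fun b hb k hk =>
    (Finset.single_le_sum (fun k _ => norm_nonneg (W.coeff f b k)) hk).trans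
      (Finset.single_le_sum (f := fun b => ∑ k ∈ box d n, ‖W.coeff f b k‖)
        (fun b _ => Finset.sum_nonneg fun k _ => norm_nonneg (W.coeff f b k)) hb)
  refine ⟨∑ b ∈ Gen.below d n, ∑ k ∈ box d n, ‖W.coeff f b k‖, fun b k => ?_⟩
  have h1 := W.coeff_trunc p n f b k
  rw [hn] at h1
  split_ifs at h1 with h
  · exact h0 b h.1 k h.2
  · rw [h1, norm_zero]
    exact Finset.sum_nonneg fun b _ => Finset.sum_nonneg fun k _ => norm_nonneg (W.coeff f b k)

variable {p}

/-- The synthesis inequality: by Hölder's inequality with the weights `|atom b k x|`, whose sum is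
at most `A`, the `L^p` norm of a combination of atoms of one generator is controlled by the `ℓ^p`
norm of its coefficients. -/
theorem eLpNorm_sum_atom_le (hp : p ≠ ∞) {A : ℝ≥0}
    (hA : ∀ b : Gen d, (∀ x, ∑' k : Fin d → ℤ, ‖W.gen b (x - latticePoint k)‖ₑ ≤ A) ∧
      ∫⁻ x, ‖W.gen b x‖ₑ ≤ A) (b : Gen d) (t : Finset (Fin d → ℤ)) (c : (Fin d → ℤ) → ℂ) :
    eLpNorm (fun x => ∑ k ∈ t, c k * W.atom b k x) p volume ≤
      A * ENNReal.ofReal (2 ^ (-((d : ℝ) / p.toReal * b.scale))) *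
        (∑ k ∈ t, ‖c k‖ₑ ^ p.toReal) ^ (1 / p.toReal) := by
  have hp1 : 1 ≤ p := Fact.out
  have hp0 : p ≠ 0 := (zero_lt_one.trans_le hp1).ne'
  set P := p.toReal with hP
  have hP1 : 1 ≤ P := by
    rw [← ENNReal.toReal_one]
    exact ENNReal.toReal_mono hp hp1
  have hP0 : 0 < P := by positivity
  have h1 : ∀ x, ‖∑ k ∈ t, c k * W.atom b k x‖ₑ ^ P ≤
      (A : ℝ≥0∞) ^ (P - 1) * ∑ k ∈ t, ‖c k‖ₑ ^ P * ‖W.atom b k x‖ₑ := fun x => by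
    calc ‖∑ k ∈ t, c k * W.atom b k x‖ₑ ^ P
        ≤ (∑ k ∈ t, ‖W.atom b k x‖ₑ * ‖c k‖ₑ) ^ P := by
          gcongr
          refine (enorm_sum_le _ _).trans (Finset.sum_le_sum fun k _ => ?_)
          rw [enorm_mul, mul_comm]
      _ ≤ ((∑ k ∈ t, ‖W.atom b k x‖ₑ) ^ (1 - P⁻¹) *
            (∑ k ∈ t, ‖W.atom b k x‖ₑ * ‖c k‖ₑ ^ P) ^ P⁻¹) ^ P := by
          gcongr
          exact ENNReal.inner_le_weight_mul_Lp_of_nonneg t hP1 _ _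
      _ = (∑ k ∈ t, ‖W.atom b k x‖ₑ) ^ (P - 1) * ∑ k ∈ t, ‖W.atom b k x‖ₑ * ‖c k‖ₑ ^ P := by
          rw [ENNReal.mul_rpow_of_nonneg _ _ hP0.le, ← ENNReal.rpow_mul, ← ENNReal.rpow_mul,
            inv_mul_cancel₀ hP0.ne', ENNReal.rpow_one, sub_mul, one_mul, inv_mul_cancel₀ hP0.ne']
      _ ≤ (A : ℝ≥0∞) ^ (P - 1) * ∑ k ∈ t, ‖c k‖ₑ ^ P * ‖W.atom b k x‖ₑ := by
          refine mul_le_mul' (ENNReal.rpow_le_rpow ?_ (by linarith)) ?_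
          · exact (ENNReal.sum_le_tsum t).trans ((hA b).1 ((2 : ℝ) ^ b.scale • x))
          · exact (Finset.sum_congr rfl fun k _ => mul_comm _ _).le
  have h2 : ∀ k, ∫⁻ x, ‖W.atom b k x‖ₑ ≤ ENNReal.ofReal (2 ^ (-((d : ℝ) * b.scale))) * A := by
    intro k
    refine le_trans (le_of_eq ?_) (mul_le_mul_right (hA b).2 _)
    rw [← W.lintegral_comp_atom (fun z => ‖z‖ₑ) b k, ← mul_assoc,
      ← ENNReal.ofReal_mul (by positivity)]
    have : ((d : ℝ) * b.scale) = ((d * b.scale : ℕ) : ℝ) := by push_cast; rfl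
    rw [this, Real.rpow_neg (by norm_num), Real.rpow_natCast, inv_mul_cancel₀ (by positivity)]
    simp
  have hmeas : ∀ k, AEMeasurable (fun x => ‖W.atom b k x‖ₑ) volume := fun k =>
    (W.atom_continuous b k).aestronglyMeasurable.enorm
  rw [eLpNorm_eq_lintegral_rpow_enorm_toReal hp0 hp, ← hP]
  have h3 : ∫⁻ x, ‖∑ k ∈ t, c k * W.atom b k x‖ₑ ^ P ≤
      (A : ℝ≥0∞) ^ P * ENNReal.ofReal (2 ^ (-((d : ℝ) * b.scale))) * ∑ k ∈ t, ‖c k‖ₑ ^ P := by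
    calc ∫⁻ x, ‖∑ k ∈ t, c k * W.atom b k x‖ₑ ^ P
        ≤ ∫⁻ x, (A : ℝ≥0∞) ^ (P - 1) * ∑ k ∈ t, ‖c k‖ₑ ^ P * ‖W.atom b k x‖ₑ :=
          lintegral_mono h1
      _ = (A : ℝ≥0∞) ^ (P - 1) * ∑ k ∈ t, ‖c k‖ₑ ^ P * ∫⁻ x, ‖W.atom b k x‖ₑ := by
          rw [lintegral_const_mul' _ _ (ENNReal.rpow_ne_top_of_nonneg (by linarith)
            ENNReal.coe_ne_top), lintegral_finsetSum' _ fun k _ => (hmeas k).const_mul _]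
          congr 1
          refine Finset.sum_congr rfl fun k _ => ?_
          rw [lintegral_const_mul' _ _ (ENNReal.rpow_ne_top_of_nonneg hP0.le enorm_ne_top)]
      _ ≤ (A : ℝ≥0∞) ^ (P - 1) * ∑ k ∈ t, ‖c k‖ₑ ^ P *
            (ENNReal.ofReal (2 ^ (-((d : ℝ) * b.scale))) * A) := by
          gcongr with k
          exact h2 k
      _ = ((A : ℝ≥0∞) ^ (P - 1) * A) * ENNReal.ofReal (2 ^ (-((d : ℝ) * b.scale))) *
            ∑ k ∈ t, ‖c k‖ₑ ^ P := by
          rw [← Finset.sum_mul]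
          ring
      _ = _ := by
          congr 2
          conv_lhs => rw [← ENNReal.rpow_one (A : ℝ≥0∞), ← ENNReal.rpow_mul, one_mul,
            ← ENNReal.rpow_add_of_nonneg _ _ (by linarith) zero_le_one, sub_add_cancel]
  refine (ENNReal.rpow_le_rpow h3 (by positivity)).trans (le_of_eq ?_)
  rw [ENNReal.mul_rpow_of_nonneg _ _ (by positivity), ENNReal.mul_rpow_of_nonneg _ _ (by positivity),
    ← ENNReal.rpow_mul, mul_one_div_cancel hP0.ne', ENNReal.rpow_one,
    ENNReal.ofReal_rpow_of_pos (by positivity), ← Real.rpow_mul (by norm_num)]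
  congr 4
  ring

end WaveletSystem

/-! ### Norms of sequences -/

theorem eLpNorm_count_eq {α ε : Type*} [MeasurableSpace α] [MeasurableSingletonClass α]
    [TopologicalSpace ε] [ContinuousENorm ε] {p : ℝ≥0∞} (h0 : p ≠ 0) (hp : p ≠ ∞) (u : α → ε) :
    eLpNorm u p Measure.count = (∑' a, ‖u a‖ₑ ^ p.toReal) ^ (1 / p.toReal) := by
  rw [eLpNorm_eq_lintegral_rpow_enorm_toReal h0 hp, lintegral_count]

theorem lowerSemicontinuous_eLpNorm_count {X α ε : Type*} [TopologicalSpace X] [MeasurableSpace α]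
    [MeasurableSingletonClass α] [TopologicalSpace ε] [ContinuousENorm ε] {p : ℝ≥0∞} (h0 : p ≠ 0)
    (hp : p ≠ ∞) {u : X → α → ε} (hu : ∀ a, LowerSemicontinuous fun x => ‖u x a‖ₑ) :
    LowerSemicontinuous fun x => eLpNorm (u x) p Measure.count := by
  simp only [eLpNorm_count_eq h0 hp]
  have hP : 0 < p.toReal := ENNReal.toReal_pos h0 hp
  refine ENNReal.continuous_rpow_const.comp_lowerSemicontinuous
    (lowerSemicontinuous_tsum fun a => ?_) (ENNReal.monotone_rpow_of_nonneg (by positivity))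
  exact ENNReal.continuous_rpow_const.comp_lowerSemicontinuous (hu a)
    (ENNReal.monotone_rpow_of_nonneg hP.le)

/-- Dominated convergence in `ℓ^p`. -/
theorem tendsto_eLpNorm_count_zero {α ε : Type*} [MeasurableSpace α] [DiscreteMeasurableSpace α]
    [TopologicalSpace ε] [ContinuousENorm ε] {p : ℝ≥0∞} (h0 : p ≠ 0) (hp : p ≠ ∞)
    {v : ℕ → α → ε} {F : α → ℝ≥0∞} (hF : eLpNorm F p Measure.count < ∞)
    (hvF : ∀ n a, ‖v n a‖ₑ ≤ F a) (hv : ∀ a, Tendsto (fun n => ‖v n a‖ₑ) atTop (𝓝 0)) :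
    Tendsto (fun n => eLpNorm (v n) p Measure.count) atTop (𝓝 0) := by
  have hP : 0 < p.toReal := ENNReal.toReal_pos h0 hp
  have h1 : Tendsto (fun n => ∫⁻ a, ‖v n a‖ₑ ^ p.toReal ∂Measure.count) atTop
      (𝓝 (∫⁻ _, 0 ∂(Measure.count : Measure α))) := by
    refine tendsto_lintegral_of_dominated_convergence (fun a => F a ^ p.toReal)
      (fun n => Measurable.of_discrete) (fun n => Eventually.of_forall fun a => ?_) ?_
      (Eventually.of_forall fun a => ?_)
    · have := hvF n a
      dsimp only
      gcongr
    · exact (lintegral_rpow_enorm_lt_top_of_eLpNorm_lt_top h0 hp hF).ne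
    · have := (ENNReal.continuous_rpow_const (y := p.toReal)).tendsto 0 |>.comp (hv a)
      rwa [ENNReal.zero_rpow_of_pos hP] at this
  rw [lintegral_zero] at h1
  have h2 := (ENNReal.continuous_rpow_const (y := 1 / p.toReal)).tendsto 0 |>.comp h1
  rw [ENNReal.zero_rpow_of_pos (by positivity)] at h2
  simpa only [eLpNorm_eq_lintegral_rpow_enorm_toReal h0 hp, Function.comp_def] using h2

/-- A functional on a normed group which is lower semicontinuous inherits the convergence of its
Cauchy sequences from convergence in norm. -/
theorem ExtendedNorm.tendsto_of_lowerSemicontinuous {G : Type*} [NormedAddCommGroup G]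
    {N : ExtendedNorm G} (hN : LowerSemicontinuous N.toFun) (u : ℕ → N.Space) (g : G)
    (hu : CauchySeq u) (hg : Tendsto (fun n => (u n).val) atTop (𝓝 g)) :
    Tendsto (fun n => N.toFun ((u n).val - g)) atTop (𝓝 0) := by
  refine ENNReal.tendsto_nhds_zero.2 fun ε hε => ?_
  obtain ⟨n0, hn0⟩ := exists_toFun_sub_le_of_cauchySeq hu hε
  filter_upwards [eventually_ge_atTop n0] with n hn
  have hcl : IsClosed {h : G | N.toFun ((u n).val - h) ≤ ε} :=
    (hN.comp (continuous_const.sub continuous_id)).isClosed_preimage ε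
  refine hcl.mem_of_tendsto hg ?_
  filter_upwards [eventually_ge_atTop n0] with m hm
  exact hn0 n hn m hm

/-! ### Besov spaces: bounded coefficients are dense, and completeness for positive regularity -/

namespace WaveletSystem

variable {d r : ℕ} (W : WaveletSystem d r) {p q : ℝ≥0∞} [Fact (1 ≤ p)] [Fact (1 ≤ q)]

/-- The quantity `ε_j` of the Besov norm. -/
def besovLevel (s : ℝ) (p : ℝ≥0∞) (f : RSpace d → ℂ) (j : ℕ) : ℝ≥0∞ :=
  ENNReal.ofReal (2 ^ ((s - d / p.toReal) * j)) *
    eLpNorm (fun a : Fin (2 ^ d - 1) × (Fin d → ℤ) => W.waveletCoeff f j a.1 a.2) p Measure.count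

theorem besov_toFun (s : ℝ) (f : Lp ℂ p (volume : Measure (RSpace d))) :
    (W.besov s p q).toFun f = eLpNorm (W.scalingCoeff f) p Measure.count +
      eLpNorm (W.besovLevel s p f) q Measure.count := rfl

theorem besovLevel_le (s : ℝ) (f : Lp ℂ p (volume : Measure (RSpace d))) (j : ℕ) :
    W.besovLevel s p f j ≤ (W.besov s p q).toFun f := by
  have hq1 : 1 ≤ q := Fact.out
  have h1 := enorm_le_eLpNorm_count (W.besovLevel s p f) j (p := q) (zero_lt_one.trans_le hq1).ne'
  rw [enorm_eq_self] at h1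
  exact h1.trans (by rw [besov_toFun]; exact le_add_self)

theorem eLpNorm_waveletCoeff_le (s : ℝ) (f : Lp ℂ p (volume : Measure (RSpace d))) (j : ℕ) :
    eLpNorm (fun a : Fin (2 ^ d - 1) × (Fin d → ℤ) => W.waveletCoeff f j a.1 a.2) p Measure.count ≤
      ENNReal.ofReal (2 ^ (-((s - d / p.toReal) * j))) * (W.besov s p q).toFun f := by
  refine le_trans (le_of_eq ?_) (mul_le_mul_right (W.besovLevel_le (q := q) s f j) _)
  rw [besovLevel, ← mul_assoc, ← ENNReal.ofReal_mul (by positivity), ← Real.rpow_add (by norm_num),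
    neg_add_cancel]
  simp

theorem exists_norm_coeff_le_besov (s : ℝ) (b : Gen d) :
    ∃ K : ℝ, ∀ (f : (W.besov s p q).Space) k, ‖W.coeff f.val b k‖ ≤ K * ‖f‖ := by
  have hp1 : 1 ≤ p := Fact.out
  have hp0 : p ≠ 0 := (zero_lt_one.trans_le hp1).ne'
  have key : ∀ (K : ℝ), 0 ≤ K → (∀ (f : (W.besov s p q).Space) k,
      ‖W.coeff f.val b k‖ₑ ≤ ENNReal.ofReal K * (W.besov s p q).toFun f.val) →
      ∀ (f : (W.besov s p q).Space) k, ‖W.coeff f.val b k‖ ≤ K * ‖f‖ := fun K hK h f k => by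
    have h1 := h f k
    rw [← f.ofReal_norm, ← ENNReal.ofReal_mul hK, ← _root_.ofReal_norm] at h1
    exact (ENNReal.ofReal_le_ofReal_iff (by positivity)).1 h1
  cases b with
  | none =>
    refine ⟨1, key 1 zero_le_one fun f k => ?_⟩
    rw [coeff_none, ENNReal.ofReal_one, one_mul, besov_toFun]
    exact (enorm_le_eLpNorm_count _ k hp0).trans le_self_add
  | some a =>
    refine ⟨2 ^ (-((s - d / p.toReal) * a.1)), key _ (by positivity) fun f k => ?_⟩
    exact (enorm_le_eLpNorm_count (fun b : Fin (2 ^ d - 1) × (Fin d → ℤ) =>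
      W.waveletCoeff f.val a.1 b.1 b.2) (a.2, k) hp0).trans (W.eLpNorm_waveletCoeff_le s f.val a.1)

theorem lowerSemicontinuous_besov (s : ℝ) (hp : p ≠ ∞) (hq : q ≠ ∞) :
    LowerSemicontinuous (W.besov s p q).toFun := by
  have hp1 : 1 ≤ p := Fact.out
  have hp0 : p ≠ 0 := (zero_lt_one.trans_le hp1).ne'
  have hq1 : 1 ≤ q := Fact.out
  have hq0 : q ≠ 0 := (zero_lt_one.trans_le hq1).ne'
  have hc : ∀ b k, LowerSemicontinuous
      fun f : Lp ℂ p (volume : Measure (RSpace d)) => ‖W.coeff f b k‖ₑ := fun b k => by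
    simp only [← coeffCLM_apply]
    exact (W.coeffCLM p b k).continuous.enorm.lowerSemicontinuous
  refine LowerSemicontinuous.add (lowerSemicontinuous_eLpNorm_count hp0 hp fun k => ?_)
    (lowerSemicontinuous_eLpNorm_count hq0 hq fun j => ?_)
  · simpa only [coeff_none] using hc none k
  · simp only [enorm_eq_self]
    exact (ENNReal.continuous_const_mul ENNReal.ofReal_ne_top).comp_lowerSemicontinuous
      (lowerSemicontinuous_eLpNorm_count hp0 hp fun a => hc (some (j, a.1)) a.2)
      fun x y h => mul_le_mul_right h _

/-- Dominated convergence for the Besov norm, in terms of the coefficients. -/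
theorem tendsto_besov_zero (s : ℝ) (hp : p ≠ ∞) (hq : q ≠ ∞)
    {f : Lp ℂ p (volume : Measure (RSpace d))} (hf : (W.besov s p q).toFun f < ∞)
    {g : ℕ → Lp ℂ p (volume : Measure (RSpace d))}
    (hle : ∀ n b k, ‖W.coeff (g n) b k‖ₑ ≤ ‖W.coeff f b k‖ₑ)
    (hlim : ∀ b k, Tendsto (fun n => ‖W.coeff (g n) b k‖ₑ) atTop (𝓝 0)) :
    Tendsto (fun n => (W.besov s p q).toFun (g n)) atTop (𝓝 0) := by
  have hp1 : 1 ≤ p := Fact.out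
  have hp0 : p ≠ 0 := (zero_lt_one.trans_le hp1).ne'
  have hq1 : 1 ≤ q := Fact.out
  have hq0 : q ≠ 0 := (zero_lt_one.trans_le hq1).ne'
  rw [besov_toFun, ENNReal.add_lt_top] at hf
  have hlevel : ∀ j, eLpNorm (fun a : Fin (2 ^ d - 1) × (Fin d → ℤ) =>
      W.waveletCoeff f j a.1 a.2) p Measure.count < ∞ := fun j => by
    have h1 := (enorm_le_eLpNorm_count (W.besovLevel s p f) j hq0).trans_lt hf.2
    rw [enorm_eq_self, besovLevel] at h1
    exact ENNReal.lt_top_of_mul_ne_top_right h1.ne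
      (ENNReal.ofReal_pos.2 (by positivity)).ne'
  have hle' : ∀ n j (a : Fin (2 ^ d - 1) × (Fin d → ℤ)), ‖W.waveletCoeff (g n) j a.1 a.2‖ₑ ≤
      ‖W.waveletCoeff f j a.1 a.2‖ₑ := fun n j a => by
    simpa only [coeff_some] using hle n (some (j, a.1)) a.2
  have hlim' : ∀ j (a : Fin (2 ^ d - 1) × (Fin d → ℤ)),
      Tendsto (fun n => ‖W.waveletCoeff (g n) j a.1 a.2‖ₑ) atTop (𝓝 0) := fun j a => by
    simpa only [coeff_some] using hlim (some (j, a.1)) a.2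
  have hA : Tendsto (fun n => eLpNorm (W.scalingCoeff (g n)) p Measure.count) atTop (𝓝 0) := by
    refine tendsto_eLpNorm_count_zero hp0 hp (F := fun k => ‖W.scalingCoeff f k‖ₑ) ?_
      (fun n k => ?_) fun k => ?_
    · simpa only [eLpNorm_enorm] using hf.1
    · simpa only [coeff_none] using hle n none k
    · simpa only [coeff_none] using hlim none k
  have hB : Tendsto (fun n => eLpNorm (W.besovLevel s p (g n)) q Measure.count) atTop (𝓝 0) := by
    refine tendsto_eLpNorm_count_zero hq0 hq hf.2 (fun n j => ?_) fun j => ?_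
    · rw [enorm_eq_self, besovLevel, besovLevel]
      gcongr
      exact eLpNorm_mono_enorm fun a => hle' n j a
    · have h1 : Tendsto (fun n => eLpNorm (fun a : Fin (2 ^ d - 1) × (Fin d → ℤ) =>
          W.waveletCoeff (g n) j a.1 a.2) p Measure.count) atTop (𝓝 0) := by
        refine tendsto_eLpNorm_count_zero hp0 hp
          (v := fun n (a : Fin (2 ^ d - 1) × (Fin d → ℤ)) => W.waveletCoeff (g n) j a.1 a.2)
          (F := fun a : Fin (2 ^ d - 1) × (Fin d → ℤ) => ‖W.waveletCoeff f j a.1 a.2‖ₑ) ?_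
          (fun n a => hle' n j a) fun a => hlim' j a
        simpa only [eLpNorm_enorm] using hlevel j
      have h2 := ENNReal.Tendsto.const_mul (a := ENNReal.ofReal (2 ^ ((s - d / p.toReal) * j))) h1
        (Or.inr ENNReal.ofReal_ne_top)
      simpa only [besovLevel, enorm_eq_self, mul_zero] using h2
  simpa only [besov_toFun, add_zero] using hA.add hB

theorem tendsto_besov_sub_trunc (s : ℝ) (hp : p ≠ ∞) (hq : q ≠ ∞)
    {f : Lp ℂ p (volume : Measure (RSpace d))} (hf : (W.besov s p q).toFun f < ∞) :
    Tendsto (fun n => (W.besov s p q).toFun (f - W.trunc p n f)) atTop (𝓝 0) := by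
  classical
  have hco : ∀ n b k, W.coeff ⇑(f - W.trunc p n f) b k =
      if b ∈ Gen.below d n ∧ k ∈ box d n then 0 else W.coeff f b k := fun n b k => by
    rw [coeff_sub, coeff_trunc]
    split_ifs <;> simp
  refine W.tendsto_besov_zero s hp hq hf (fun n b k => ?_) fun b k => ?_
  · rw [hco]
    split_ifs <;> simp
  · refine tendsto_const_nhds.congr' ?_
    filter_upwards [b.eventually_mem_below, eventually_mem_box k] with n h1 h2
    rw [hco, if_pos ⟨h1, h2⟩, enorm_zero]

theorem dense_atomSpan_besov (s : ℝ) (hp : p ≠ ∞) (hq : q ≠ ∞) :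
    Dense {f : (W.besov s p q).Space | f.val ∈ W.atomSpan p} :=
  ExtendedNorm.dense_of_tendsto fun f => ⟨fun n => W.trunc p n f.val,
    W.tendsto_besov_sub_trunc s hp hq f.toFun_val_lt_top,
    fun n => W.trunc_mem_atomSpan p n f.val⟩

theorem dense_tameSet_besov (s : ℝ) (hp : p ≠ ∞) (hq : q ≠ ∞) :
    Dense (W.tameSet (W.besov s p q)) :=
  (W.dense_atomSpan_besov s hp hq).mono fun _ hf => W.exists_norm_coeff_le_of_mem_atomSpan p hf

/-- For `s > 0` the Besov norm dominates the `L^p` norm on the finite combinations of atoms: by the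
synthesis inequality the part of scale `l` has `L^p` norm at most a constant times `2^{-sl} ε_l`. -/
theorem exists_norm_le_besov {s : ℝ} (hs : 0 < s) (hp : p ≠ ∞) :
    ∃ C : ℝ, ∀ f : (W.besov s p q).Space, f.val ∈ W.atomSpan p → ‖f.val‖ ≤ C * ‖f‖ := by
  have hp1 : 1 ≤ p := Fact.out
  have hp0 : p ≠ 0 := (zero_lt_one.trans_le hp1).ne'
  obtain ⟨A, hA⟩ := W.exists_gen_bound
  set ρ : ℝ := 2 ^ (-s) with hρ
  have hρ0 : 0 ≤ ρ := by positivity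
  have hρ1 : ρ < 1 := Real.rpow_lt_one_of_one_lt_of_neg (by norm_num) (by linarith)
  refine ⟨A + ∑' l : ℕ, (2 ^ d - 1 : ℕ) * (A * ρ ^ l), fun f hf => ?_⟩
  have hsum : Summable fun l : ℕ => ((2 ^ d - 1 : ℕ) : ℝ) * (A * ρ ^ l) :=
    ((summable_geometric_of_lt_one hρ0 hρ1).mul_left _).mul_left _
  obtain ⟨n, hn⟩ := (W.eventually_trunc_eq p hf).exists
  rw [trunc_apply] at hn
  -- the norm of the part of the sum which belongs to one generator
  have hgen : ∀ b : Gen d, ‖∑ k ∈ box d n, W.coeff f.val b k • W.atomLp p b k‖ ≤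
      A * ρ ^ b.scale * ‖f‖ := fun b => by
    have h1 : ⇑(∑ k ∈ box d n, W.coeff f.val b k • W.atomLp p b k) =ᵐ[volume]
        fun x => ∑ k ∈ box d n, W.coeff f.val b k * W.atom b k x := by
      have h2 : ∀ᵐ x ∂(volume : Measure (RSpace d)), ∀ k ∈ box d n,
          (W.coeff f.val b k • W.atomLp p b k : Lp ℂ p (volume : Measure (RSpace d))) x =
            W.coeff f.val b k * W.atom b k x := by
        refine (Finset.eventually_all _).2 fun k _ => ?_
        filter_upwards [Lp.coeFn_smul (W.coeff f.val b k) (W.atomLp p b k),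
          (W.atom_memLp (q := p) Fact.out b k).coeFn_toLp] with x h3 h4
        rw [h3, Pi.smul_apply, atomLp, h4, smul_eq_mul]
      filter_upwards [Lp.coeFn_finsetSum (box d n) fun k =>
        (W.coeff f.val b k • W.atomLp p b k : Lp ℂ p (volume : Measure (RSpace d))), h2] with x h3 h4
      rw [h3, Finset.sum_apply]
      exact Finset.sum_congr rfl h4
    have h2 := W.eLpNorm_sum_atom_le hp hA b (box d n) (W.coeff f.val b)
    rw [← eLpNorm_congr_ae h1] at h2
    have h3 : (∑ k ∈ box d n, ‖W.coeff f.val b k‖ₑ ^ p.toReal) ^ (1 / p.toReal) ≤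
        ENNReal.ofReal (2 ^ (-((s - d / p.toReal) * b.scale))) *
          (W.besov s p q).toFun f.val := by
      cases b with
      | none =>
        simp only [coeff_none, Gen.scale, Nat.cast_zero, mul_zero, neg_zero, Real.rpow_zero,
          ENNReal.ofReal_one, one_mul]
        refine le_trans ?_ (le_self_add : _ ≤ (W.besov s p q).toFun f.val)
        rw [eLpNorm_count_eq hp0 hp]
        gcongr
        exact ENNReal.sum_le_tsum _
      | some a =>
        refine le_trans ?_ (W.eLpNorm_waveletCoeff_le s f.val a.1)
        rw [eLpNorm_count_eq hp0 hp]
        gcongr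
        refine le_trans (le_of_eq ?_) (ENNReal.sum_le_tsum
          ((box d n).map ⟨fun k => (a.2, k), Prod.mk_right_injective a.2⟩))
        rw [Finset.sum_map]
        rfl
    have h4 := h2.trans (mul_le_mul_right h3 _)
    rw [← f.ofReal_norm, ← ENNReal.ofReal_coe_nnreal, ← ENNReal.ofReal_mul (by positivity),
      ← ENNReal.ofReal_mul (by positivity), ← ENNReal.ofReal_mul (by positivity)] at h4
    rw [Lp.norm_def]
    refine ENNReal.toReal_le_of_le_ofReal (by positivity) (h4.trans (le_of_eq ?_))
    have h5 : (2 : ℝ) ^ (-((d : ℝ) / p.toReal * b.scale)) *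
        2 ^ (-((s - d / p.toReal) * b.scale)) = ρ ^ b.scale := by
      rw [← Real.rpow_add (by norm_num), hρ, ← Real.rpow_natCast, ← Real.rpow_mul (by norm_num)]
      congr 1
      ring
    rw [← h5]
    congr 1
    ring
  calc ‖f.val‖ = ‖∑ b ∈ Gen.below d n, ∑ k ∈ box d n, W.coeff f.val b k • W.atomLp p b k‖ := by
        rw [hn]
    _ ≤ ∑ b ∈ Gen.below d n, A * ρ ^ b.scale * ‖f‖ :=
        (norm_sum_le _ _).trans (Finset.sum_le_sum fun b _ => hgen b)
    _ = (A + ∑ l ∈ Finset.range n, (2 ^ d - 1 : ℕ) * (A * ρ ^ l)) * ‖f‖ := by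
        rw [← Finset.sum_mul, Gen.below, Finset.sum_insertNone, Finset.sum_product]
        simp [Gen.scale]
    _ ≤ _ := by
        gcongr
        exact hsum.sum_le_tsum _ fun _ _ => by positivity

/-- For `s > 0` a Cauchy sequence of finite combinations of atoms converges in `L^p`, and its limit
in `L^p` is a limit in the Besov norm since this norm is lower semicontinuous on `L^p`. -/
theorem completeSpace_besov {s : ℝ} (hs : 0 < s) (hp : p ≠ ∞) (hq : q ≠ ∞) :
    CompleteSpace (W.besov s p q).Space := by
  obtain ⟨C, hC⟩ := W.exists_norm_le_besov (q := q) hs hp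
  exact ExtendedNorm.completeSpace_of_dense (W.atomSpan p).toAddSubgroup
    (W.dense_atomSpan_besov s hp hq) hC
    (ExtendedNorm.tendsto_of_lowerSemicontinuous (W.lowerSemicontinuous_besov s hp hq))

end WaveletSystem

/-! ### Translations on `L^p` and local averages -/

section Translation

variable {E : Type*} [NormedAddCommGroup E] [MeasurableSpace E] [BorelSpace E]
  {μ : Measure E} [μ.IsAddRightInvariant]
  {p : ℝ≥0∞}

/-- The translate `f(· + c)` of `f`. -/
def MeasureTheory.Lp.translate (c : E) (f : Lp ℂ p μ) : Lp ℂ p μ :=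
  Lp.compMeasurePreserving (· + c) (measurePreserving_add_right μ c) f

theorem MeasureTheory.Lp.coeFn_translate (c : E) (f : Lp ℂ p μ) :
    Lp.translate c f =ᵐ[μ] fun x => f (x + c) :=
  Lp.coeFn_compMeasurePreserving f (measurePreserving_add_right μ c)

theorem MeasureTheory.Lp.translate_zero (f : Lp ℂ p μ) : Lp.translate 0 f = f := by
  refine Lp.ext ((Lp.coeFn_translate 0 f).trans ?_)
  simp

theorem MeasureTheory.Lp.continuous_translate [Fact (1 ≤ p)] [μ.InnerRegularCompactLTTop]
    [IsLocallyFiniteMeasure μ] (hp : p ≠ ∞) (f : Lp ℂ p μ) :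
    Continuous fun c => Lp.translate c f := by
  have h1 : Continuous fun c : E => (⟨fun x : E => x + c, by fun_prop⟩ : C(E, E)) :=
    ContinuousMap.continuous_of_continuous_uncurry _ (by
      change Continuous fun z : E × E => z.2 + z.1
      fun_prop)
  exact Continuous.compMeasurePreservingLp continuous_const h1
    (fun c => measurePreserving_add_right μ c) hp

end Translation

section LocalAverage

variable {d : ℕ} {p : ℝ≥0∞} [Fact (1 ≤ p)]

/-- The average of the translates `f(· + t)`, `‖t‖ < ε`. -/
def localAverage (ε : ℝ) (f : Lp ℂ p (volume : Measure (RSpace d))) :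
    Lp ℂ p (volume : Measure (RSpace d)) :=
  ⨍ t in Metric.ball (0 : RSpace d) ε, Lp.translate t f

theorem integrableOn_translate (hp : p ≠ ∞) (ε : ℝ) (f : Lp ℂ p (volume : Measure (RSpace d))) :
    IntegrableOn (fun t => Lp.translate t f) (Metric.ball (0 : RSpace d) ε) volume :=
  ((Lp.continuous_translate hp f).continuousOn.integrableOn_compact
    (isCompact_closedBall 0 ε)).mono_set Metric.ball_subset_closedBall

theorem localAverage_mem (hp : p ≠ ∞) {ε : ℝ} (hε : 0 < ε)
    (f : Lp ℂ p (volume : Measure (RSpace d))) {K : Set (Lp ℂ p (volume : Measure (RSpace d)))}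
    (hK : Convex ℝ K) (hKc : IsClosed K)
    (h : ∀ t ∈ Metric.ball (0 : RSpace d) ε, Lp.translate t f ∈ K) : localAverage ε f ∈ K :=
  hK.set_average_mem hKc (Metric.measure_ball_pos _ _ hε).ne' measure_ball_lt_top.ne
    (ae_restrict_of_forall_mem measurableSet_ball h) (integrableOn_translate hp ε f)

theorem localAverage_prodMk_mem (hp : p ≠ ∞) {ε : ℝ} (hε : 0 < ε)
    (f g : Lp ℂ p (volume : Measure (RSpace d)))
    {K : Set (Lp ℂ p (volume : Measure (RSpace d)) × Lp ℂ p (volume : Measure (RSpace d)))}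
    (hK : Convex ℝ K) (hKc : IsClosed K)
    (h : ∀ t ∈ Metric.ball (0 : RSpace d) ε, (Lp.translate t f, Lp.translate t g) ∈ K) :
    (localAverage ε f, localAverage ε g) ∈ K := by
  have h1 := hK.set_average_mem hKc (Metric.measure_ball_pos volume (0 : RSpace d) hε).ne'
    measure_ball_lt_top.ne (ae_restrict_of_forall_mem measurableSet_ball h)
    ((integrableOn_translate hp ε f).prodMk (integrableOn_translate hp ε g))
  rwa [average_pair (integrableOn_translate hp ε f) (integrableOn_translate hp ε g)] at h1

/-- Local averages are bounded functions: their integrals against a function `h` are controlled by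
the `L¹` norm of `h`. -/
theorem lintegral_integral_translate_le (hp : p ≠ ∞) (ε : ℝ)
    (f : Lp ℂ p (volume : Measure (RSpace d))) :
    ∃ M : ℝ≥0∞, M ≠ ∞ ∧ ∀ h : RSpace d → ℂ, Continuous h →
      ∫⁻ t in Metric.ball (0 : RSpace d) ε, ‖∫ x, h x * Lp.translate t f x‖ₑ ≤
        M * ∫⁻ x, ‖h x‖ₑ := by
  have hp1 : 1 ≤ p := Fact.out
  have hp0 : p ≠ 0 := (zero_lt_one.trans_le hp1).ne'
  have hP1 : 1 ≤ p.toReal := by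
    rw [← ENNReal.toReal_one]
    exact ENNReal.toReal_mono hp hp1
  refine ⟨volume (Metric.ball (0 : RSpace d) ε) + ∫⁻ x, ‖f x‖ₑ ^ p.toReal,
    ENNReal.add_ne_top.2 ⟨measure_ball_lt_top.ne,
      (lintegral_rpow_enorm_lt_top_of_eLpNorm_lt_top hp0 hp (Lp.eLpNorm_lt_top f)).ne⟩,
    fun h hh => ?_⟩
  have hf : Measurable f := (Lp.stronglyMeasurable f).measurable
  have h1 : ∀ y : ℝ≥0∞, y ≤ 1 + y ^ p.toReal := fun y => by
    rcases le_total y 1 with hy | hy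
    · exact hy.trans le_self_add
    · exact (ENNReal.le_rpow_self_of_one_le hy hP1).trans le_add_self
  have h2 : ∀ x, ∫⁻ t in Metric.ball (0 : RSpace d) ε, ‖f (x + t)‖ₑ ≤
      volume (Metric.ball (0 : RSpace d) ε) + ∫⁻ x, ‖f x‖ₑ ^ p.toReal := fun x => by
    refine (lintegral_mono fun t => h1 _).trans ?_
    rw [lintegral_add_left measurable_const]
    refine add_le_add (by simp) ((setLIntegral_le_lintegral _ _).trans (le_of_eq ?_))
    exact lintegral_add_left_eq_self (fun y => ‖f y‖ₑ ^ p.toReal) x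
  calc ∫⁻ t in Metric.ball (0 : RSpace d) ε, ‖∫ x, h x * Lp.translate t f x‖ₑ
      ≤ ∫⁻ t in Metric.ball (0 : RSpace d) ε, ∫⁻ x, ‖h x‖ₑ * ‖f (x + t)‖ₑ := by
        refine lintegral_mono fun t => (enorm_integral_le_lintegral_enorm _).trans (le_of_eq ?_)
        refine lintegral_congr_ae ?_
        filter_upwards [Lp.coeFn_translate t f] with x hx
        rw [hx, enorm_mul]
    _ = ∫⁻ x, ∫⁻ t in Metric.ball (0 : RSpace d) ε, ‖h x‖ₑ * ‖f (x + t)‖ₑ := by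
        refine lintegral_lintegral_swap (Measurable.aemeasurable ?_)
        have := hh.measurable
        fun_prop
    _ ≤ ∫⁻ x, (volume (Metric.ball (0 : RSpace d) ε) + ∫⁻ x, ‖f x‖ₑ ^ p.toReal) * ‖h x‖ₑ := by
        refine lintegral_mono fun x => ?_
        rw [lintegral_const_mul' _ _ enorm_ne_top, mul_comm]
        exact mul_le_mul_left (h2 x) _
    _ = _ := lintegral_const_mul _ hh.measurable.enorm

theorem WaveletSystem.exists_norm_coeff_localAverage_le {r : ℕ} (W : WaveletSystem d r)
    (hp : p ≠ ∞) (ε : ℝ) (f : Lp ℂ p (volume : Measure (RSpace d))) :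
    ∃ M : ℝ, ∀ b k, ‖W.coeff (localAverage ε f) b k‖ ≤ M := by
  obtain ⟨M, hM, h⟩ := lintegral_integral_translate_le hp ε f
  obtain ⟨A, hA⟩ := W.exists_gen_bound
  set v := volume.real (Metric.ball (0 : RSpace d) ε) with hv
  refine ⟨v⁻¹ * (M * A).toReal, fun b k => ?_⟩
  have h1 : W.coeff (localAverage ε f) b k =
      v⁻¹ • ∫ t in Metric.ball (0 : RSpace d) ε, W.coeff (Lp.translate t f) b k := by
    simp only [← coeffCLM_apply]
    rw [ContinuousLinearMap.integral_comp_comm _ (integrableOn_translate hp ε f), localAverage,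
      setAverage_eq, ← hv, ContinuousLinearMap.map_smul_of_tower]
  have hc : Continuous (W.dualAtom b k) := by
    rw [dualAtom_eq_conj]
    exact (continuous_const.mul (W.atom_continuous b k)).star
  have h2 := h _ hc
  rw [lintegral_dualAtom] at h2
  have h3 : ‖∫ t in Metric.ball (0 : RSpace d) ε, W.coeff (Lp.translate t f) b k‖ₑ ≤ M * A :=
    (enorm_integral_le_lintegral_enorm _).trans (h2.trans (mul_le_mul_right (hA b).2 _))
  rw [h1, norm_smul, norm_inv, Real.norm_of_nonneg measureReal_nonneg]
  gcongr
  rw [← toReal_enorm]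
  exact ENNReal.toReal_mono (ENNReal.mul_ne_top hM ENNReal.coe_ne_top) h3

end LocalAverage

/-! ### Translation-continuous functionals -/

section Functionals

variable {d : ℕ} {p : ℝ≥0∞}

/-- The difference quotient whose `L^p` norm is the Gagliardo seminorm. -/
def gagliardoQuot (p : ℝ≥0∞) (σ : ℝ) (g : RSpace d → ℂ) (z : RSpace d × RSpace d) : ℂ :=
  (g z.1 - g z.2) / ((‖z.1 - z.2‖ ^ (d / p.toReal + σ) : ℝ) : ℂ)

theorem gagliardoENorm_eq (σ : ℝ) (g : Lp ℂ p (volume : Measure (RSpace d))) :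
    gagliardoENorm σ g = eLpNorm (gagliardoQuot p σ g) p (volume.prod volume) := rfl

theorem aestronglyMeasurable_gagliardoQuot (σ : ℝ) (g : Lp ℂ p (volume : Measure (RSpace d))) :
    AEStronglyMeasurable (gagliardoQuot p σ g) (volume.prod volume) := by
  have hf := (Lp.stronglyMeasurable g).measurable
  refine Measurable.aestronglyMeasurable ?_
  unfold gagliardoQuot
  fun_prop

theorem gagliardoENorm_smul_le (σ : ℝ) (c : ℝ) (f : Lp ℂ p (volume : Measure (RSpace d))) :
    gagliardoENorm σ (c • f) ≤ ENNReal.ofReal |c| * gagliardoENorm σ f := by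
  have h1 := gagliardoENorm_congr p σ _ _ (Lp.coeFn_smul c f)
  rw [gagliardoENorm, eLpNorm_congr_ae h1, gagliardoENorm_eq, ← Real.enorm_eq_ofReal_abs,
    ← eLpNorm_const_smul]
  refine le_of_eq (congrArg (fun v => eLpNorm v p (volume.prod volume)) ?_)
  funext z
  simp only [Pi.smul_apply, gagliardoQuot, ← smul_sub, smul_div_assoc]

variable [Fact (1 ≤ p)]

/-- A lower semicontinuous extended seminorm on `L^p` for which translation is continuous at the
functions of finite seminorm. -/
structure IsTranslationContinuous (Φ : Lp ℂ p (volume : Measure (RSpace d)) → ℝ≥0∞) : Prop where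
  lsc : LowerSemicontinuous Φ
  add_le : ∀ f g, Φ (f + g) ≤ Φ f + Φ g
  smul_le : ∀ (c : ℝ) f, Φ (c • f) ≤ ENNReal.ofReal |c| * Φ f
  tendsto : ∀ g, Φ g < ∞ → Tendsto (fun t => Φ (g - Lp.translate t g)) (𝓝 0) (𝓝 0)

/-- The sublevel sets of `h ↦ Φ (g - h)` are closed and convex, so that local averages of `g`, being
averages of translates of `g`, converge to `g`. -/
theorem IsTranslationContinuous.tendsto_localAverage
    {Φ : Lp ℂ p (volume : Measure (RSpace d)) → ℝ≥0∞} (hΦ : IsTranslationContinuous Φ) (hp : p ≠ ∞)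
    {g : Lp ℂ p (volume : Measure (RSpace d))} (hg : Φ g < ∞) :
    Tendsto (fun n : ℕ => Φ (g - localAverage (1 / ((n : ℝ) + 1)) g)) atTop (𝓝 0) := by
  refine ENNReal.tendsto_nhds_zero.2 fun δ hδ => ?_
  obtain ⟨ρ, hρ, hball⟩ := Metric.eventually_nhds_iff_ball.1
    (ENNReal.tendsto_nhds_zero.1 (hΦ.tendsto g hg) δ hδ)
  filter_upwards [tendsto_one_div_add_atTop_nhds_zero_nat.eventually (gt_mem_nhds hρ)] with n hn
  refine localAverage_mem hp (by positivity) g (K := {h | Φ (g - h) ≤ δ}) ?_ ?_ fun t ht =>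
    hball t (Metric.ball_subset_ball hn.le ht)
  · intro h1 hh1 h2 hh2 a b ha hb hab
    have h3 : g - (a • h1 + b • h2) = a • (g - h1) + b • (g - h2) := by
      rw [smul_sub, smul_sub, sub_add_sub_comm, ← add_smul, hab, one_smul]
    change Φ _ ≤ δ
    rw [h3]
    calc Φ (a • (g - h1) + b • (g - h2)) ≤ ENNReal.ofReal |a| * Φ (g - h1) +
          ENNReal.ofReal |b| * Φ (g - h2) :=
          (hΦ.add_le _ _).trans (add_le_add (hΦ.smul_le _ _) (hΦ.smul_le _ _))
      _ ≤ ENNReal.ofReal |a| * δ + ENNReal.ofReal |b| * δ := by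
          gcongr
          exacts [hh1, hh2]
      _ = δ := by
          rw [← add_mul, abs_of_nonneg ha, abs_of_nonneg hb, ← ENNReal.ofReal_add ha hb, hab]
          simp
  · exact (hΦ.lsc.comp (continuous_const.sub continuous_id)).isClosed_preimage δ

theorem lpENorm_eq_enorm (f : Lp ℂ p (volume : Measure (RSpace d))) : lpENorm f = ‖f‖ₑ :=
  (Lp.enorm_def f).symm

theorem isTranslationContinuous_lpENorm (hp : p ≠ ∞) :
    IsTranslationContinuous (lpENorm : Lp ℂ p (volume : Measure (RSpace d)) → ℝ≥0∞) where
  lsc := by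
    rw [show (lpENorm : Lp ℂ p (volume : Measure (RSpace d)) → ℝ≥0∞) = fun f => ‖f‖ₑ from
      funext lpENorm_eq_enorm]
    exact continuous_enorm.lowerSemicontinuous
  add_le := lpENorm_add_le
  smul_le c f := by
    rw [lpENorm_eq_enorm, lpENorm_eq_enorm, enorm_smul, Real.enorm_eq_ofReal_abs]
  tendsto g _ := by
    simp only [lpENorm_eq_enorm]
    have h1 : Continuous fun t : RSpace d => ‖g - Lp.translate t g‖ₑ :=
      (continuous_const.sub (Lp.continuous_translate hp g)).enorm
    simpa [Lp.translate_zero] using h1.tendsto 0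

theorem lowerSemicontinuous_gagliardoENorm (σ : ℝ) :
    LowerSemicontinuous (gagliardoENorm σ : Lp ℂ p (volume : Measure (RSpace d)) → ℝ≥0∞) := by
  refine lowerSemicontinuous_iff_isClosed_preimage.2 fun δ => IsSeqClosed.isClosed ?_
  intro u g hu hg
  have h1 : TendstoInMeasure volume (fun n => (u n : RSpace d → ℂ)) atTop g :=
    tendstoInMeasure_of_tendsto_Lp hg
  obtain ⟨ns, -, hns⟩ := h1.exists_seq_tendsto_ae
  have h2 : ∀ᵐ z ∂((volume : Measure (RSpace d)).prod volume), Tendsto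
      (fun n => gagliardoQuot p σ (u (ns n)) z) atTop (𝓝 (gagliardoQuot p σ g z)) := by
    filter_upwards [Measure.quasiMeasurePreserving_fst.ae hns,
      Measure.quasiMeasurePreserving_snd.ae hns] with z hz1 hz2
    exact (hz1.sub hz2).div_const _
  have h3 := Lp.eLpNorm_lim_le_liminf_eLpNorm (p := p)
    (fun n => aestronglyMeasurable_gagliardoQuot σ (u (ns n))) _ h2
  refine h3.trans (liminf_le_of_frequently_le' (Frequently.of_forall fun n => ?_))
  exact hu (ns n)

theorem gagliardoENorm_sub_translate (σ : ℝ)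
    {g : Lp ℂ p (volume : Measure (RSpace d))} (hg : gagliardoENorm σ g < ∞) :
    ∃ Q : Lp ℂ p ((volume : Measure (RSpace d)).prod volume), ∀ t,
      gagliardoENorm σ (g - Lp.translate t g) = ‖Q - Lp.translate (t, t) Q‖ₑ := by
  have hm : MemLp (gagliardoQuot p σ g) p (volume.prod volume) :=
    ⟨aestronglyMeasurable_gagliardoQuot σ g, hg⟩
  refine ⟨hm.toLp _, fun t => ?_⟩
  have h1 : ⇑(g - Lp.translate t g) =ᵐ[volume] fun x => g x - g (x + t) := by
    filter_upwards [Lp.coeFn_sub g (Lp.translate t g), Lp.coeFn_translate t g] with x h1 h2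
    rw [h1, Pi.sub_apply, h2]
  have h2 := gagliardoENorm_congr p σ _ _ h1
  rw [Lp.enorm_def, gagliardoENorm]
  refine eLpNorm_congr_ae (h2.trans ?_)
  filter_upwards [Lp.coeFn_sub (hm.toLp _) (Lp.translate (t, t) (hm.toLp _)),
    Lp.coeFn_translate (t, t) (hm.toLp _), hm.coeFn_toLp,
    (measurePreserving_add_right ((volume : Measure (RSpace d)).prod volume)
      (t, t)).quasiMeasurePreserving.ae hm.coeFn_toLp] with z h3 h4 h5 h6
  rw [h3, Pi.sub_apply, h4, h5, h6]
  simp only [gagliardoQuot, Prod.fst_add, Prod.snd_add, add_sub_add_right_eq_sub]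
  ring

theorem isTranslationContinuous_gagliardoENorm (hp : p ≠ ∞) (σ : ℝ) :
    IsTranslationContinuous
      (gagliardoENorm σ : Lp ℂ p (volume : Measure (RSpace d)) → ℝ≥0∞) where
  lsc := lowerSemicontinuous_gagliardoENorm σ
  add_le := gagliardoENorm_add_le σ
  smul_le := gagliardoENorm_smul_le σ
  tendsto g hg := by
    obtain ⟨Q, hQ⟩ := gagliardoENorm_sub_translate σ hg
    simp only [hQ]
    have h1 : Continuous fun t : RSpace d => ‖Q - Lp.translate (t, t) Q‖ₑ :=
      (continuous_const.sub ((Lp.continuous_translate hp Q).comp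
        (continuous_id.prodMk continuous_id))).enorm
    have h2 := h1.tendsto 0
    rwa [Prod.mk_zero_zero, Lp.translate_zero, sub_self, enorm_zero] at h2

/-! ### Operators on distributions which commute with translations -/

/-- The operator `T` commutes with translations. The translate of a distribution is defined by
duality. -/
def CommutesWithTranslations (T : 𝓢'(RSpace d, ℂ) →L[ℂ] 𝓢'(RSpace d, ℂ)) : Prop :=
  ∀ (u v : 𝓢'(RSpace d, ℂ)) (t : RSpace d), (∀ η, v η = u (η.compSubConstCLM ℂ t)) →
    ∀ η, T v η = T u (η.compSubConstCLM ℂ t)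

theorem translate_toTemperedDistribution (f : Lp ℂ p (volume : Measure (RSpace d))) (t : RSpace d)
    (η : 𝓢(RSpace d, ℂ)) :
    (Lp.translate t f : 𝓢'(RSpace d, ℂ)) η = (f : 𝓢'(RSpace d, ℂ)) (η.compSubConstCLM ℂ t) := by
  simp only [Lp.toTemperedDistribution_apply, SchwartzMap.compSubConstCLM_apply]
  rw [← integral_add_right_eq_self (fun x => η (x - t) • f x) t]
  refine integral_congr_ae ?_
  filter_upwards [Lp.coeFn_translate t f] with x hx
  simp [hx]

/-- An operator which commutes with translations commutes with local averages: its graph is a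
closed subspace of `L^p × L^p` which is invariant under translations. -/
theorem CommutesWithTranslations.localAverage {T : 𝓢'(RSpace d, ℂ) →L[ℂ] 𝓢'(RSpace d, ℂ)}
    (hT : CommutesWithTranslations T) (hp : p ≠ ∞) {f g : Lp ℂ p (volume : Measure (RSpace d))}
    (hfg : T (f : 𝓢'(RSpace d, ℂ)) = g) {ε : ℝ} (hε : 0 < ε) :
    T (localAverage ε f : 𝓢'(RSpace d, ℂ)) = localAverage ε g := by
  have hc := (Lp.toTemperedDistributionCLM ℂ (volume : Measure (RSpace d)) p).continuous
  refine localAverage_prodMk_mem hp hε f g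
    (K := {z | T (z.1 : 𝓢'(RSpace d, ℂ)) = (z.2 : 𝓢'(RSpace d, ℂ))}) ?_ ?_ fun t _ => ?_
  · intro x hx y hy a b _ _ _
    have hx' : T (x.1 : 𝓢'(RSpace d, ℂ)) = (x.2 : 𝓢'(RSpace d, ℂ)) := hx
    have hy' : T (y.1 : 𝓢'(RSpace d, ℂ)) = (y.2 : 𝓢'(RSpace d, ℂ)) := hy
    simp only [Set.mem_ofPred_eq, Prod.fst_add, Prod.snd_add, Prod.smul_fst, Prod.smul_snd,
      ← Lp.toTemperedDistributionCLM_apply, map_add, ContinuousLinearMap.map_smul_of_tower] at *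
    rw [hx', hy']
  · exact isClosed_eq (T.continuous.comp (hc.comp continuous_fst)) (hc.comp continuous_snd)
  · ext η
    rw [hT f _ t (translate_toTemperedDistribution f t), hfg, translate_toTemperedDistribution]

theorem commutesWithTranslations_id :
    CommutesWithTranslations (ContinuousLinearMap.id ℂ 𝓢'(RSpace d, ℂ)) :=
  fun _ _ _ h => h

theorem commutesWithTranslations_lineDerivOp (m : RSpace d) :
    CommutesWithTranslations (LineDeriv.lineDerivOpCLM ℂ 𝓢'(RSpace d, ℂ) m) := by
  intro u v t h η
  have h1 : ∂_{m} (η.compSubConstCLM ℂ t) = (∂_{m} η).compSubConstCLM ℂ t := by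
    ext x
    rw [SchwartzMap.compSubConstCLM_apply, SchwartzMap.lineDerivOp_apply_eq_fderiv,
      SchwartzMap.lineDerivOp_apply_eq_fderiv]
    exact congrArg (fun L : RSpace d →L[ℝ] ℂ => L m) (fderiv_comp_sub (f := η) t)
  simp only [LineDeriv.lineDerivOpCLM_apply, TemperedDistribution.lineDerivOp_apply_apply, h, h1, map_neg]

theorem commutesWithTranslations_iteratedLineDerivOp {n : ℕ} (m : Fin n → RSpace d) :
    CommutesWithTranslations (LineDeriv.iteratedLineDerivOpCLM ℂ 𝓢'(RSpace d, ℂ) m) := by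
  induction n with
  | zero => exact commutesWithTranslations_id
  | succ n ih =>
    intro u v t h η
    simp only [LineDeriv.iteratedLineDerivOpCLM_apply, LineDeriv.iteratedLineDerivOp_succ_left]
    exact commutesWithTranslations_lineDerivOp (m 0) _ _ t (ih (Fin.tail m) u v t h) η

open FourierTransform in
theorem fourierInv_compSubConstCLM (t : RSpace d) (η : 𝓢(RSpace d, ℂ)) (ξ : RSpace d) :
    𝓕⁻ (η.compSubConstCLM ℂ t) ξ = Real.fourierChar (inner ℝ t ξ) • 𝓕⁻ η ξ := by
  rw [SchwartzMap.fourierInv_coe, SchwartzMap.fourierInv_coe, Real.fourierInv_eq,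
    Real.fourierInv_eq, ← integral_add_right_eq_self _ t, Circle.smul_def, ← integral_smul]
  refine integral_congr_ae (Eventually.of_forall fun x => ?_)
  simp only [SchwartzMap.compSubConstCLM_apply, add_sub_cancel_right, inner_add_left,
    AddChar.map_add_eq_mul, mul_smul]
  rw [smul_comm, Circle.smul_def]

open FourierTransform in
/-- A Fourier multiplier commutes with translations, since these correspond to the multiplication
of the Fourier transform by a character. -/
theorem commutesWithTranslations_besselPotential (s : ℝ) :
    CommutesWithTranslations (TemperedDistribution.besselPotential (RSpace d) ℂ s) := by
  intro u v t h η
  have hg : (fun x : RSpace d => (((1 + ‖x‖ ^ 2) ^ (s / 2) : ℝ) : ℂ)).HasTemperateGrowth := by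
    fun_prop
  rw [TemperedDistribution.besselPotential, TemperedDistribution.fourierMultiplierCLM_apply_apply,
    TemperedDistribution.fourierMultiplierCLM_apply_apply, h]
  congr 1
  ext x
  rw [SchwartzMap.compSubConstCLM_apply, SchwartzMap.fourier_coe, SchwartzMap.fourier_coe,
    Real.fourier_eq, Real.fourier_eq]
  refine integral_congr_ae (Eventually.of_forall fun ξ => ?_)
  simp only [SchwartzMap.smulLeftCLM_apply_apply hg, fourierInv_compSubConstCLM]
  rw [smul_comm _ (Real.fourierChar _) (𝓕⁻ η ξ), ← mul_smul, ← AddChar.map_add_eq_mul]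
  congr 3
  rw [inner_sub_right, real_inner_comm t ξ]
  ring

end Functionals

/-! ### Functionals of distributions given by functions -/

section Extend

variable {d : ℕ} {p : ℝ≥0∞} [Fact (1 ≤ p)]
  {Φ : Lp ℂ p (volume : Measure (RSpace d)) → ℝ≥0∞}

theorem toTemperedDistribution_injective {f g : Lp ℂ p (volume : Measure (RSpace d))}
    (h : (f : 𝓢'(RSpace d, ℂ)) = g) : f = g :=
  LinearMap.ker_eq_bot.1 (Lp.ker_toTemperedDistributionCLM_eq_bot (F := ℂ)
    (μ := (volume : Measure (RSpace d))) (p := p)) h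

theorem toTemperedDistribution_sub (f g : Lp ℂ p (volume : Measure (RSpace d))) :
    ((f - g : Lp ℂ p (volume : Measure (RSpace d))) : 𝓢'(RSpace d, ℂ)) =
      (f : 𝓢'(RSpace d, ℂ)) - (g : 𝓢'(RSpace d, ℂ)) := by
  simp only [← Lp.toTemperedDistributionCLM_apply, map_sub]

/-- A distribution is given by at most one function of `L^p`. -/
theorem extendENorm_eq {u : 𝓢'(RSpace d, ℂ)} {g : Lp ℂ p (volume : Measure (RSpace d))}
    (h : u = (g : 𝓢'(RSpace d, ℂ))) : extendENorm Φ u = Φ g := by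
  refine le_antisymm (iInf₂_le g h.symm) (le_iInf₂ fun f hf => ?_)
  rw [toTemperedDistribution_injective (hf.trans h)]

theorem exists_of_extendENorm_lt_top {u : 𝓢'(RSpace d, ℂ)} (h : extendENorm Φ u < ∞) :
    ∃ g : Lp ℂ p (volume : Measure (RSpace d)), u = (g : 𝓢'(RSpace d, ℂ)) ∧ Φ g < ∞ := by
  obtain ⟨g, hg⟩ := iInf_lt_iff.1 h
  obtain ⟨h1, h2⟩ := iInf_lt_iff.1 hg
  exact ⟨g, h1.symm, h2⟩

variable {T : 𝓢'(RSpace d, ℂ) →L[ℂ] 𝓢'(RSpace d, ℂ)}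

theorem tendsto_extendENorm_sub_localAverage (hT : CommutesWithTranslations T)
    (hΦ : IsTranslationContinuous Φ) (hp : p ≠ ∞) {f : Lp ℂ p (volume : Measure (RSpace d))}
    (hf : extendENorm Φ (T (f : 𝓢'(RSpace d, ℂ))) < ∞) :
    Tendsto (fun n : ℕ => extendENorm Φ (T ((f - localAverage (1 / ((n : ℝ) + 1)) f :
      Lp ℂ p (volume : Measure (RSpace d))) : 𝓢'(RSpace d, ℂ)))) atTop (𝓝 0) := by
  obtain ⟨g, hg, hgf⟩ := exists_of_extendENorm_lt_top hf
  refine (hΦ.tendsto_localAverage hp hgf).congr fun n => (extendENorm_eq ?_).symm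
  rw [toTemperedDistribution_sub, map_sub, hg, hT.localAverage hp hg (by positivity),
    toTemperedDistribution_sub]

/-- The operator `T`, defined on the functions `f` of `L^p` such that `T f` is in `L^p`, is
closed. -/
theorem exists_tendsto_of_extendENorm_cauchy {u : ℕ → Lp ℂ p (volume : Measure (RSpace d))}
    {f : Lp ℂ p (volume : Measure (RSpace d))} (hu : Tendsto u atTop (𝓝 f))
    (hfin : ∀ n, extendENorm (p := p) lpENorm (T (u n : 𝓢'(RSpace d, ℂ))) < ∞)
    (hc : ∀ ε > 0, ∃ n₀, ∀ n ≥ n₀, ∀ m ≥ n₀, extendENorm (p := p) lpENorm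
      (T ((u n - u m : Lp ℂ p (volume : Measure (RSpace d))) : 𝓢'(RSpace d, ℂ))) ≤ ε) :
    ∃ (g : ℕ → Lp ℂ p (volume : Measure (RSpace d))) (g₀ : Lp ℂ p (volume : Measure (RSpace d))),
      (∀ n, T (u n : 𝓢'(RSpace d, ℂ)) = g n) ∧ T (f : 𝓢'(RSpace d, ℂ)) = g₀ ∧
        Tendsto g atTop (𝓝 g₀) := by
  choose g hg _ using fun n => exists_of_extendENorm_lt_top (hfin n)
  have h1 : CauchySeq g := by
    refine EMetric.cauchySeq_iff.2 fun ε hε => ?_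
    obtain ⟨n₀, hn₀⟩ := hc (ε / 2) (ENNReal.half_pos hε.ne')
    by_cases hεt : ε = ∞
    · exact ⟨0, fun m _ n _ => by rw [hεt]; exact edist_lt_top _ _⟩
    refine ⟨n₀, fun m hm n hn => ?_⟩
    have h2 := hn₀ m hm n hn
    rw [extendENorm_eq (g := g m - g n), lpENorm_eq_enorm] at h2
    · rw [edist_eq_enorm_sub]
      exact h2.trans_lt (ENNReal.half_lt_self hε.ne' hεt)
    · rw [toTemperedDistribution_sub, map_sub, hg, hg, toTemperedDistribution_sub]
  obtain ⟨g₀, hg₀⟩ := cauchySeq_tendsto_of_complete h1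
  refine ⟨g, g₀, hg, ?_, hg₀⟩
  have hcont := (Lp.toTemperedDistributionCLM ℂ (volume : Measure (RSpace d)) p).continuous
  have h3 := ((T.continuous.comp hcont).tendsto f).comp hu
  have h4 := (hcont.tendsto g₀).comp hg₀
  refine tendsto_nhds_unique h3 (h4.congr fun n => ?_)
  exact (hg n).symm

theorem tendsto_extendENorm_sub (hΦ : LowerSemicontinuous Φ)
    {u g : ℕ → Lp ℂ p (volume : Measure (RSpace d))}
    {f g₀ : Lp ℂ p (volume : Measure (RSpace d))}
    (hg : ∀ n, T (u n : 𝓢'(RSpace d, ℂ)) = g n) (hf : T (f : 𝓢'(RSpace d, ℂ)) = g₀)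
    (hg₀ : Tendsto g atTop (𝓝 g₀))
    (hc : ∀ ε > 0, ∃ n₀, ∀ n ≥ n₀, ∀ m ≥ n₀, extendENorm Φ
      (T ((u n - u m : Lp ℂ p (volume : Measure (RSpace d))) : 𝓢'(RSpace d, ℂ))) ≤ ε) :
    Tendsto (fun n => extendENorm Φ
      (T ((u n - f : Lp ℂ p (volume : Measure (RSpace d))) : 𝓢'(RSpace d, ℂ)))) atTop (𝓝 0) := by
  refine ENNReal.tendsto_nhds_zero.2 fun ε hε => ?_
  obtain ⟨n₀, hn₀⟩ := hc ε hε
  filter_upwards [eventually_ge_atTop n₀] with n hn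
  have h1 : T ((u n - f : Lp ℂ p (volume : Measure (RSpace d))) : 𝓢'(RSpace d, ℂ)) =
      ((g n - g₀ : Lp ℂ p (volume : Measure (RSpace d))) : 𝓢'(RSpace d, ℂ)) := by
    rw [toTemperedDistribution_sub, map_sub, hg, hf, toTemperedDistribution_sub]
  rw [extendENorm_eq h1]
  have hcl : IsClosed {h | Φ (g n - h) ≤ ε} :=
    (hΦ.comp (continuous_const.sub continuous_id)).isClosed_preimage ε
  refine hcl.mem_of_tendsto hg₀ ?_
  filter_upwards [eventually_ge_atTop n₀] with m hm
  have h2 := hn₀ n hn m hm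
  rwa [extendENorm_eq (g := g n - g m)] at h2
  rw [toTemperedDistribution_sub, map_sub, hg, hg, toTemperedDistribution_sub]

/-! ### Sobolev spaces: bounded coefficients are dense, and completeness -/

/-- The iterated partial derivative, as an operator on tempered distributions. -/
def partialDerivCLM {n : ℕ} (a : Fin n → Fin d) : 𝓢'(RSpace d, ℂ) →L[ℂ] 𝓢'(RSpace d, ℂ) :=
  LineDeriv.iteratedLineDerivOpCLM ℂ 𝓢'(RSpace d, ℂ)
    fun i => (EuclideanSpace.single (a i) (1 : ℝ) : RSpace d)

theorem commutesWithTranslations_partialDerivCLM {n : ℕ} (a : Fin n → Fin d) :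
    CommutesWithTranslations (partialDerivCLM a) :=
  commutesWithTranslations_iteratedLineDerivOp _

theorem sobolev_toFun (s : ℝ) (f : Lp ℂ p (volume : Measure (RSpace d))) :
    (sobolev d s p).toFun f = (∑ n ∈ Finset.range (⌊s⌋₊ + 1), ∑ a : Fin n → Fin d,
      extendENorm (p := p) lpENorm (partialDerivCLM a (f : 𝓢'(RSpace d, ℂ)))) +
    (if s = ⌊s⌋₊ then 0 else ∑ a : Fin ⌊s⌋₊ → Fin d,
      extendENorm (p := p) (gagliardoENorm (s - ⌊s⌋₊))
        (partialDerivCLM a (f : 𝓢'(RSpace d, ℂ)))) := rfl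

theorem extendENorm_lpENorm_le_sobolev (s : ℝ) {n : ℕ} (hn : n ≤ ⌊s⌋₊) (a : Fin n → Fin d)
    (f : Lp ℂ p (volume : Measure (RSpace d))) :
    extendENorm (p := p) lpENorm (partialDerivCLM a (f : 𝓢'(RSpace d, ℂ))) ≤
      (sobolev d s p).toFun f := by
  rw [sobolev_toFun]
  refine le_trans ?_ le_self_add
  refine le_trans ?_ (Finset.single_le_sum (f := fun n => ∑ a : Fin n → Fin d,
    extendENorm (p := p) lpENorm (partialDerivCLM a (f : 𝓢'(RSpace d, ℂ))))
    (fun _ _ => zero_le) (Finset.mem_range.2 (Nat.lt_succ_of_le hn)))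
  exact Finset.single_le_sum (f := fun a : Fin n → Fin d =>
    extendENorm (p := p) lpENorm (partialDerivCLM a (f : 𝓢'(RSpace d, ℂ))))
    (fun _ _ => zero_le) (Finset.mem_univ a)

theorem extendENorm_gagliardoENorm_le_sobolev {s : ℝ} (hs : s ≠ ⌊s⌋₊) (a : Fin ⌊s⌋₊ → Fin d)
    (f : Lp ℂ p (volume : Measure (RSpace d))) :
    extendENorm (p := p) (gagliardoENorm (s - ⌊s⌋₊)) (partialDerivCLM a (f : 𝓢'(RSpace d, ℂ))) ≤
      (sobolev d s p).toFun f := by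
  rw [sobolev_toFun, if_neg hs]
  refine le_trans ?_ le_add_self
  exact Finset.single_le_sum (f := fun a : Fin ⌊s⌋₊ → Fin d =>
    extendENorm (p := p) (gagliardoENorm (s - ⌊s⌋₊)) (partialDerivCLM a (f : 𝓢'(RSpace d, ℂ))))
    (fun _ _ => zero_le) (Finset.mem_univ a)

theorem tendsto_finsetSum_zero {ι : Type*} {t : Finset ι} {F : ι → ℕ → ℝ≥0∞}
    (h : ∀ i ∈ t, Tendsto (F i) atTop (𝓝 0)) :
    Tendsto (fun k => ∑ i ∈ t, F i k) atTop (𝓝 0) := by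
  simpa using tendsto_finsetSum t h

/-- The Sobolev norm tends to `0` if each of its finitely many terms does. -/
theorem tendsto_sobolev_zero (s : ℝ) {v : ℕ → Lp ℂ p (volume : Measure (RSpace d))}
    (h1 : ∀ n ≤ ⌊s⌋₊, ∀ a : Fin n → Fin d, Tendsto (fun k => extendENorm (p := p) lpENorm
      (partialDerivCLM a (v k : 𝓢'(RSpace d, ℂ)))) atTop (𝓝 0))
    (h2 : s ≠ ⌊s⌋₊ → ∀ a : Fin ⌊s⌋₊ → Fin d, Tendsto (fun k => extendENorm (p := p)
      (gagliardoENorm (s - ⌊s⌋₊)) (partialDerivCLM a (v k : 𝓢'(RSpace d, ℂ)))) atTop (𝓝 0)) :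
    Tendsto (fun k => (sobolev d s p).toFun (v k)) atTop (𝓝 0) := by
  simp only [sobolev_toFun]
  rw [← add_zero (0 : ℝ≥0∞)]
  refine Tendsto.add ?_ ?_
  · refine tendsto_finsetSum_zero fun n hn => tendsto_finsetSum_zero fun a _ => ?_
    exact h1 n (Nat.lt_succ_iff.1 (Finset.mem_range.1 hn)) a
  · split_ifs with hs
    · simp
    · exact tendsto_finsetSum_zero fun a _ => h2 hs a

theorem enorm_le_sobolev (s : ℝ) (f : Lp ℂ p (volume : Measure (RSpace d))) :
    ‖f‖ₑ ≤ (sobolev d s p).toFun f := by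
  have h := extendENorm_lpENorm_le_sobolev s (Nat.zero_le _) (Fin.elim0 : Fin 0 → Fin d) f
  have h0 : partialDerivCLM (Fin.elim0 : Fin 0 → Fin d) (f : 𝓢'(RSpace d, ℂ)) = f := rfl
  rwa [extendENorm_eq h0, lpENorm_eq_enorm] at h

theorem enorm_le_besselSobolev (s : ℝ) (f : Lp ℂ p (volume : Measure (RSpace d))) :
    ‖f‖ₑ ≤ (besselSobolev d s p).toFun f := by
  rw [← lpENorm_eq_enorm]
  exact le_self_add

theorem tendsto_sobolev_sub_localAverage (s : ℝ) (hp : p ≠ ∞)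
    {f : Lp ℂ p (volume : Measure (RSpace d))} (hf : (sobolev d s p).toFun f < ∞) :
    Tendsto (fun n : ℕ => (sobolev d s p).toFun (f - localAverage (1 / ((n : ℝ) + 1)) f)) atTop
      (𝓝 0) :=
  tendsto_sobolev_zero s
    (fun _ hn a => tendsto_extendENorm_sub_localAverage
      (commutesWithTranslations_partialDerivCLM a) (isTranslationContinuous_lpENorm hp) hp
      ((extendENorm_lpENorm_le_sobolev s hn a f).trans_lt hf))
    (fun hs a => tendsto_extendENorm_sub_localAverage
      (commutesWithTranslations_partialDerivCLM a) (isTranslationContinuous_gagliardoENorm hp _) hp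
      ((extendENorm_gagliardoENorm_le_sobolev hs a f).trans_lt hf))

theorem tendsto_besselSobolev_sub_localAverage (s : ℝ) (hp : p ≠ ∞)
    {f : Lp ℂ p (volume : Measure (RSpace d))} (hf : (besselSobolev d s p).toFun f < ∞) :
    Tendsto (fun n : ℕ => (besselSobolev d s p).toFun (f - localAverage (1 / ((n : ℝ) + 1)) f))
      atTop (𝓝 0) := by
  obtain ⟨h1, h2⟩ := ENNReal.add_lt_top.1 hf
  have h3 := ((isTranslationContinuous_lpENorm hp).tendsto_localAverage hp h1).add
    (tendsto_extendENorm_sub_localAverage (commutesWithTranslations_besselPotential s)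
      (isTranslationContinuous_lpENorm hp) hp h2)
  rwa [add_zero] at h3

theorem ExtendedNorm.norm_val_le {N : ExtendedNorm (Lp ℂ p (volume : Measure (RSpace d)))}
    (h : ∀ f, ‖f‖ₑ ≤ N.toFun f) (f : N.Space) : ‖f.val‖ ≤ ‖f‖ := by
  rw [Space.norm_def, ← toReal_enorm]
  exact ENNReal.toReal_mono f.toFun_val_lt_top.ne (h _)

/-- A Cauchy sequence of the Sobolev space converges in `L^p`, together with its derivatives; the
Gagliardo seminorms are controlled by their lower semicontinuity. -/
theorem completeSpace_sobolev (s : ℝ) (hp : p ≠ ∞) : CompleteSpace (sobolev d s p).Space := by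
  refine ExtendedNorm.completeSpace_of_dense ⊤ (by simp) (C := 1)
    (fun f _ => by simpa using ExtendedNorm.norm_val_le (enorm_le_sobolev s) f)
    fun u f hu hf => ?_
  have hcauchy := fun (ε : ℝ≥0∞) (hε : ε > 0) =>
    ExtendedNorm.exists_toFun_sub_le_of_cauchySeq hu hε
  have hderiv : ∀ n ≤ ⌊s⌋₊, ∀ a : Fin n → Fin d,
      ∃ (g : ℕ → Lp ℂ p (volume : Measure (RSpace d)))
        (g₀ : Lp ℂ p (volume : Measure (RSpace d))),
        (∀ n, partialDerivCLM a ((u n).val : 𝓢'(RSpace d, ℂ)) = g n) ∧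
          partialDerivCLM a (f : 𝓢'(RSpace d, ℂ)) = g₀ ∧ Tendsto g atTop (𝓝 g₀) :=
    fun n hn a => exists_tendsto_of_extendENorm_cauchy hf
      (fun k => (extendENorm_lpENorm_le_sobolev s hn a _).trans_lt (u k).toFun_val_lt_top)
      fun ε hε => (hcauchy ε hε).imp fun n₀ h k hk m hm =>
        (extendENorm_lpENorm_le_sobolev s hn a _).trans (h k hk m hm)
  refine tendsto_sobolev_zero s (fun n hn a => ?_) fun hs a => ?_
  · obtain ⟨g, g₀, h1, h2, h3⟩ := hderiv n hn a
    exact tendsto_extendENorm_sub (isTranslationContinuous_lpENorm hp).lsc h1 h2 h3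
      fun ε hε => (hcauchy ε hε).imp fun n₀ h k hk m hm =>
        (extendENorm_lpENorm_le_sobolev s hn a _).trans (h k hk m hm)
  · obtain ⟨g, g₀, h1, h2, h3⟩ := hderiv _ le_rfl a
    exact tendsto_extendENorm_sub (lowerSemicontinuous_gagliardoENorm _) h1 h2 h3
      fun ε hε => (hcauchy ε hε).imp fun n₀ h k hk m hm =>
        (extendENorm_gagliardoENorm_le_sobolev hs a _).trans (h k hk m hm)

theorem completeSpace_besselSobolev (s : ℝ) (hp : p ≠ ∞) :
    CompleteSpace (besselSobolev d s p).Space := by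
  refine ExtendedNorm.completeSpace_of_dense ⊤ (by simp) (C := 1)
    (fun f _ => by simpa using ExtendedNorm.norm_val_le (enorm_le_besselSobolev s) f)
    fun u f hu hf => ?_
  have hcauchy := fun (ε : ℝ≥0∞) (hε : ε > 0) =>
    ExtendedNorm.exists_toFun_sub_le_of_cauchySeq hu hε
  obtain ⟨g, g₀, h1, h2, h3⟩ := exists_tendsto_of_extendENorm_cauchy
    (T := TemperedDistribution.besselPotential (RSpace d) ℂ s) hf
    (fun k => (le_add_self.trans_lt (u k).toFun_val_lt_top))
    fun ε hε => (hcauchy ε hε).imp fun n₀ h k hk m hm => le_add_self.trans (h k hk m hm)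
  have h4 := tendsto_extendENorm_sub (isTranslationContinuous_lpENorm hp).lsc h1 h2 h3
    fun ε hε => (hcauchy ε hε).imp fun n₀ h k hk m hm => le_add_self.trans (h k hk m hm)
  have h5 : Tendsto (fun n => lpENorm ((u n).val - f)) atTop (𝓝 0) := by
    simp only [lpENorm_eq_enorm, ← edist_eq_enorm_sub]
    exact tendsto_iff_edist_tendsto_0.1 hf
  have h6 := h5.add h4
  rwa [add_zero] at h6

end Extend

namespace WaveletSystem

variable {d r : ℕ} (W : WaveletSystem d r) {p : ℝ≥0∞} [Fact (1 ≤ p)]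
  {N : ExtendedNorm (Lp ℂ p (volume : Measure (RSpace d)))}

theorem exists_norm_coeff_le_of_enorm_le (h : ∀ f, ‖f‖ₑ ≤ N.toFun f) (b : Gen d) :
    ∃ K : ℝ, ∀ (f : N.Space) k, ‖W.coeff f.val b k‖ ≤ K * ‖f‖ := by
  obtain ⟨K, hK⟩ := W.exists_norm_coeff_le p b
  refine ⟨|K|, fun f k => (hK f.val k).trans ?_⟩
  have h1 := ExtendedNorm.norm_val_le h f
  gcongr
  exact le_abs_self K

theorem dense_tameSet_of_tendsto_localAverage (hp : p ≠ ∞)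
    (h : ∀ f, N.toFun f < ∞ → Tendsto (fun n : ℕ =>
      N.toFun (f - localAverage (1 / ((n : ℝ) + 1)) f)) atTop (𝓝 0)) :
    Dense (W.tameSet N) :=
  ExtendedNorm.dense_of_tendsto (S := {f : Lp ℂ p (volume : Measure (RSpace d)) |
    ∃ M : ℝ, ∀ b k, ‖W.coeff f b k‖ ≤ M}) fun f =>
    ⟨_, h f.val f.toFun_val_lt_top, fun _ => W.exists_norm_coeff_localAverage_le hp _ f.val⟩

end WaveletSystem

end

theorem mainTheorem5 (d : ℕ) (s : ℝ) (hs : 0 ≤ s) (p q : ℝ≥0∞) [Fact (1 ≤ p)] [Fact (1 ≤ q)]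
    (hp : p ≠ ∞) (hq : q ≠ ∞) (W : WaveletSystem d (⌊s⌋₊ + 1))
    (X : ExtendedNorm (Lp ℂ p (volume : Measure (RSpace d))))
    (hX : X = W.besov s p q ∨ X = sobolev d s p ∨ X = besselSobolev d s p) :
    (∃ R : Set X.Space, R ∈ residual X.Space ∧ IsGδ R ∧ Dense R ∧ ∀ f ∈ R, ∀ x : RSpace d,
      liminf (fun j : ℕ =>
        ((Real.posLog ‖W.partialSum f.val j x‖ / (j * Real.log 2) : ℝ) : EReal)) atTop = 0) ∧
    (s * p.toReal < d →
      IsMeagre {f : X.Space | W.IsStronglyMultifractal s p.toReal f.val} ∧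
      ((X = W.besov s p q → s = 0 → BaireSpace X.Space) →
        {f : X.Space | W.IsStronglyMultifractal s p.toReal f.val} ∉ residual X.Space)) := by
  rcases hX with rfl | rfl | rfl
  · obtain ⟨h1, h2⟩ := W.generic_of_dense_tameSet (W.exists_norm_coeff_le_besov s)
      (W.dense_tameSet_besov s hp hq) s hp
    refine ⟨h1, fun hsp => ⟨(h2 hsp).1, fun hB => (h2 hsp).2 ?_⟩⟩
    rcases hs.eq_or_lt with h0 | h0
    · exact hB rfl h0.symm
    · have := W.completeSpace_besov (q := q) h0 hp hq
      infer_instance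
  · obtain ⟨h1, h2⟩ := W.generic_of_dense_tameSet
      (W.exists_norm_coeff_le_of_enorm_le (enorm_le_sobolev s))
      (W.dense_tameSet_of_tendsto_localAverage hp fun f =>
        tendsto_sobolev_sub_localAverage s hp) s hp
    have := completeSpace_sobolev (d := d) s hp
    exact ⟨h1, fun hsp => ⟨(h2 hsp).1, fun _ => (h2 hsp).2 inferInstance⟩⟩
  · obtain ⟨h1, h2⟩ := W.generic_of_dense_tameSet
      (W.exists_norm_coeff_le_of_enorm_le (enorm_le_besselSobolev s))
      (W.dense_tameSet_of_tendsto_localAverage hp fun f =>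
        tendsto_besselSobolev_sub_localAverage s hp) s hp
    have := completeSpace_besselSobolev (d := d) s hp
    exact ⟨h1, fun hsp => ⟨(h2 hsp).1, fun _ => (h2 hsp).2 inferInstance⟩⟩
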